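/- Let $V$ be a vector space of finite dimension $N$ over a field $\mathbb{F}$ and let $\eta$ be a (possibly degenerate) form on $V$ which is either Hermitian (with respect to a nontrivial involutory automorphism of $\mathbb{F}$), alternating, or quadratic. Let $d$ be the dimension of the radical $\mathrm{Rad}(\eta)$, where the radical of a quadratic form is the set of singular vectors in the radical of its bilinearization. Let $n$ be the reduced Witt index of $\eta$, that is, the maximal dimension of a totally singular subspace for the form induced by $\eta$ on $V/\mathrm{Rad}(\eta)$, and assume $n>1$. For $n<k\leq n+d$ let $\mathcal{P}_k$ be the polar $k$-Grassmannian of $\eta$, whose points are the totally $\eta$-singular $k$-dimensional subspaces of $V$, and let $\varepsilon_k$ be its Grassmann embedding, which maps $\langle v_1,\dots,v_k\rangle$ to the point $\langle v_1\wedge\dots\wedge v_k\rangle$ of $\mathrm{PG}(\bigwedge^kV)$. Let $\dim\langle\varepsilon_k(\mathcal{P}_k)\rangle$ be the dimension of the vector subspace of $\bigwedge^kV$ corresponding to the span of the image of $\varepsilon_k$. With the convention that $\binom{m}{h}=0$ when $h>m$: 1. If $\eta$ is Hermitian, or quadratic with $\mathrm{char}(\mathbb{F})\neq 2$, then \[\dim\langle\varepsilon_k(\mathcal{P}_k)\rangle=\binom{N}{k}-\sum_{i=0}^{k-n-1}\binom{N-d}{k-i}\binom{d}{i}.\]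 2. If $\eta$ is alternating, or quadratic with $\mathrm{char}(\mathbb{F})=2$, then \[\dim\langle\varepsilon_k(\mathcal{P}_k)\rangle=\binom{N}{k}-\binom{N}{k-2}-\sum_{i=0}^{k-n-1}\binom{N-d}{k-i}\binom{d}{i}+\sum_{i=0}^{k-n-1}\binom{N-d}{k-i-2}\binom{d}{i}.\] In every case $\langle\varepsilon_k(\mathcal{P}_k)\rangle$ is a proper subspace of $\mathrm{PG}(\bigwedge^kV)$. -/

import Mathlib

open scoped LinearAlgebra.Projectivization

/-- The forms considered here, on a vector space `V` over a field `F`: Hermitian forms with respect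
to an involutory (in particular nontrivial) automorphism `σ` of `F`, alternating bilinear forms,
and quadratic forms. No form is required to be non-degenerate. -/
inductive PolarForm (F V : Type*) [Field F] [AddCommGroup V] [Module F V] where
  | hermitian (σ : F →+* F) (invol : ∀ a, σ (σ a) = a) (nontriv : σ ≠ RingHom.id F)
      (h : V →ₛₗ[σ] V →ₗ[F] F) (herm : h.IsSymm) : PolarForm F V
  | alternating (f : LinearMap.BilinForm F V) (alt : f.IsAlt) : PolarForm F V
  | quadratic (q : QuadraticForm F V) : PolarForm F V

namespace PolarForm

section

variable {F V : Type*} [Field F] [AddCommGroup V] [Module F V]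

/-- `η` is a Hermitian form. -/
def IsHermitian : PolarForm F V → Prop
  | hermitian _ _ _ _ _ => True
  | alternating _ _ => False
  | quadratic _ => False

/-- `η` is an alternating form. -/
def IsAlternating : PolarForm F V → Prop
  | hermitian _ _ _ _ _ => False
  | alternating _ _ => True
  | quadratic _ => False

/-- `η` is a quadratic form. -/
def IsQuadratic : PolarForm F V → Prop
  | hermitian _ _ _ _ _ => False
  | alternating _ _ => False
  | quadratic _ => True

/-- A subspace is totally singular if the form vanishes identically on it. -/
def IsTotallySingular : PolarForm F V → Submodule F V → Prop
  | hermitian _ _ _ h _, W => ∀ x ∈ W, ∀ y ∈ W, h x y = 0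
  | alternating f _, W => ∀ x ∈ W, ∀ y ∈ W, f x y = 0
  | quadratic q, W => ∀ x ∈ W, q x = 0

/-- The radical of `η`. For a sesquilinear form this is `V^⊥`; for a quadratic form it is the
set of the singular vectors in the radical of the bilinearization. -/
def radical : PolarForm F V → Submodule F V
  | hermitian _ _ _ h _ => LinearMap.ker h
  | alternating f _ => LinearMap.ker f
  | quadratic q => q.radical

/-- The form induced by `η` on `V / Rad(η)`. -/
def reduction : (η : PolarForm F V) → PolarForm F (V ⧸ η.radical)
  | hermitian σ invol nontriv h herm =>
      hermitian σ invol nontriv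
        (LinearMap.liftQ₂ (LinearMap.ker h) (LinearMap.ker h) h le_rfl (by
          intro y hy
          ext x
          exact herm.isRefl _ _ (by rw [LinearMap.mem_ker.mp hy, LinearMap.zero_apply])))
        ⟨by
          intro x y
          induction x using Submodule.Quotient.induction_on with | _ x => ?_
          induction y using Submodule.Quotient.induction_on with | _ y => ?_
          exact herm.eq x y⟩
  | alternating f alt =>
      alternating
        (LinearMap.liftQ₂ (LinearMap.ker f) (LinearMap.ker f) f le_rfl (by
          intro y hy
          ext x
          exact alt.isRefl _ _ (by rw [LinearMap.mem_ker.mp hy, LinearMap.zero_apply])))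
        (by
          intro x
          induction x using Submodule.Quotient.induction_on with | _ x => ?_
          exact alt x)
  | quadratic q => quadratic (q.lift q.radical le_rfl)

/-- The Witt index: the largest dimension of a totally singular subspace. -/
noncomputable def wittIndex (η : PolarForm F V) : ℕ :=
  sSup {m | ∃ W : Submodule F V, η.IsTotallySingular W ∧ Module.finrank F W = m}

/-- The reduced Witt index: the Witt index of the form induced on `V / Rad(η)`. -/
noncomputable def reducedWittIndex (η : PolarForm F V) : ℕ :=
  η.reduction.wittIndex

/-- The singular defect: the dimension of the radical. -/
noncomputable def defect (η : PolarForm F V) : ℕ :=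
  Module.finrank F η.radical

end

end PolarForm

section

variable {F V : Type*} [Field F] [AddCommGroup V] [Module F V]

/-- The wedge product of a linearly independent sequence is nonzero. -/
theorem wedge_ne_zero {k : ℕ} {v : Fin k → V} (hv : LinearIndependent F v) :
    exteriorPower.ιMulti F k v ≠ 0 := by
  have h := exteriorPower.ιMulti_family_linearIndependent_field (n := k) hv
  have h0 := h.ne_zero (Set.powersetCard.ofFinEmbEquiv (RelEmbedding.refl (α := Fin k) (· ≤ ·)))
  simpa [exteriorPower.ιMulti_family] using h0

/-- The points of the `k`-Grassmannian of `V`: the `k`-dimensional subspaces of `V`. -/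
abbrev GrassmannPoint (F V : Type*) [Field F] [AddCommGroup V] [Module F V] (k : ℕ) :=
  {X : Submodule F V // Module.finrank F X = k}

/-- The Plücker embedding `e_k`, mapping `⟨v₁, …, v_k⟩` to `⟨v₁ ∧ ⋯ ∧ v_k⟩`. A basis
`v₁, …, v_k` is chosen; `pluckerEmbedding_eq` shows that any other basis gives the same point. -/
noncomputable def pluckerEmbedding [FiniteDimensional F V] (k : ℕ) (X : GrassmannPoint F V k) :
    ℙ F (⋀[F]^k V) :=
  Projectivization.mk F
    (exteriorPower.ιMulti F k fun i => (Module.finBasisOfFinrankEq F X.1 X.2 i : V))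
    (wedge_ne_zero ((Module.finBasisOfFinrankEq F X.1 X.2).linearIndependent.map'
      X.1.subtype X.1.ker_subtype))

theorem pluckerEmbedding_eq [FiniteDimensional F V] (k : ℕ) (X : GrassmannPoint F V k)
    (v : Fin k → V) (hv : LinearIndependent F v) (hX : Submodule.span F (Set.range v) = X.1) :
    pluckerEmbedding k X = Projectivization.mk F (exteriorPower.ιMulti F k v)
      (wedge_ne_zero hv) := by
  set e := Module.finBasisOfFinrankEq F X.1 X.2 with he
  have hmem : ∀ i, v i ∈ X.1 := fun i => hX ▸ Submodule.subset_span ⟨i, rfl⟩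
  let w : Fin k → X.1 := fun i => ⟨v i, hmem i⟩
  have key : exteriorPower.ιMulti F k v
      = e.det w • exteriorPower.ιMulti F k (fun i => (e i : V)) := by
    have h : (exteriorPower.ιMulti F k).compLinearMap X.1.subtype
        = (LinearMap.toSpanSingleton F _
          (exteriorPower.ιMulti F k (fun i => (e i : V)))).compAlternatingMap e.det := by
      refine Module.Basis.ext_alternating e fun i hi => ?_
      let s : Equiv.Perm (Fin k) := Equiv.ofBijective i (Finite.injective_iff_bijective.1 hi)
      change ((exteriorPower.ιMulti F k).compLinearMap X.1.subtype) (e ∘ s) =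
        ((LinearMap.toSpanSingleton F _ _).compAlternatingMap e.det) (e ∘ s)
      rw [AlternatingMap.map_perm, AlternatingMap.map_perm]
      simp [Module.Basis.det_self]
    have := congrArg (fun g => g w) h
    simpa using this
  unfold pluckerEmbedding
  refine (Projectivization.mk_eq_mk_iff' F _ _ _ _).2 ?_
  have hd : e.det w ≠ 0 := by
    intro h0
    rw [h0, zero_smul] at key
    exact wedge_ne_zero hv key
  exact ⟨(e.det w)⁻¹, by rw [key, smul_smul, inv_mul_cancel₀ hd, one_smul]⟩

namespace PolarForm

/-- The points of the polar `k`-Grassmannian `𝒫_k` of `η`: the totally singular `k`-dimensional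
subspaces of `V`. -/
abbrev GrassmannianPoint (η : PolarForm F V) (k : ℕ) :=
  {X : GrassmannPoint F V k // η.IsTotallySingular X.1}

variable [FiniteDimensional F V]

/-- The Grassmann embedding `ε_k` of the polar `k`-Grassmannian: the restriction of `e_k`. -/
noncomputable def grassmannEmbedding (η : PolarForm F V) (k : ℕ) (X : η.GrassmannianPoint k) :
    ℙ F (⋀[F]^k V) :=
  pluckerEmbedding k X.1

/-- The projective subspace `⟨ε_k(𝒫_k)⟩` of `PG(⋀^k V)`. -/
noncomputable def grassmannSpan (η : PolarForm F V) (k : ℕ) :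
    Projectivization.Subspace F (⋀[F]^k V) :=
  Projectivization.Subspace.span (Set.range (η.grassmannEmbedding k))

/-- The dimension `dim(⟨ε_k(𝒫_k)⟩)`: the dimension of the vector subspace of `⋀^k V`
corresponding to `⟨ε_k(𝒫_k)⟩`. -/
noncomputable def embeddingDim (η : PolarForm F V) (k : ℕ) : ℕ :=
  Module.finrank F (Projectivization.Subspace.submodule (η.grassmannSpan k))

end PolarForm

end

/-! Inside the exterior algebra let `polarPower U k` be the span of the powers ⋀^k T over the
totally singular subspaces T of U. For U = V this is the span of the Grassmann embedding
(`map_submodule_grassmannSpan`), so everything is a dimension count.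

Write V = W ⊕ Rad(η) and m = dim W. A totally singular subspace remains so after adjoining radical
vectors, so the span for V is the direct sum of the products ⋀^i Rad ∧ `polarPower W (k - i)`, of
dimension ∑ C(d,i) · dim `polarPower W (k - i)` (`finrank_polarPower_sup`). In degrees above n the
W-part vanishes. In degrees j ≤ n its dimension is C(m,j) in the first case and C(m,j) - C(m,j-2) in
the second. Vandermonde's identity gives the main binomials, and the lost indices i ≤ k-n-1 give the
subtracted sums. The span is proper because the lost contribution at i = k-n-1 is nonzero.

Case 1 (`polarPower_eq_wedgePower`). In a product of vectors of W the factors are replaced one at a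
time by singular vectors orthogonal to the earlier ones. The obstruction is a non-orthogonal pair s,
v with s singular. If e, f is a suitably scaled non-orthogonal pair orthogonal to the other factors,
then s + te is orthogonal to σ(t)v - f, whence σ(t) s∧v ≡ t e∧f modulo the span. Varying t
(Hermitian), or exchanging e and f (symmetric, 2 ≠ 0), forces s∧v into the span.

Case 2. On an orthogonal sum of r hyperbolic planes, powers of isotropic subspaces are fixed by the
exponential of contraction with the form, an operator available in every characteristic. The
dimension of the fixed space is bounded above, and that of the span below, by the same recurrence in
r (`finrank_wedgeFixed_sup_le`, `le_finrank_polarPower_sup`), and the two bounds meet. A radical of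
the alternating form is again split off by Vandermonde. For a quadratic form in characteristic 2,
isotropic and singular subspaces have the same span up to the Witt index
(`wedgePower_le_polarPower_of_isotropic`). -/

/-! ### Powers of subspaces in the exterior algebra, and contraction -/

section WedgePower

variable {F V : Type*} [Field F] [AddCommGroup V] [Module F V]

/-- The span, in the exterior algebra of `V`, of the `k`-fold products of vectors of `U`. -/
noncomputable def wedgePower (U : Submodule F V) (k : ℕ) : Submodule F (ExteriorAlgebra F V) :=
  (U.map (ExteriorAlgebra.ι F)) ^ k

/-- Left multiplication by a vector in the exterior algebra. -/
noncomputable def wedgeLeft (r : V) : ExteriorAlgebra F V →ₗ[F] ExteriorAlgebra F V :=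
  LinearMap.mulLeft F (ExteriorAlgebra.ι F r)

theorem wedgeLeft_apply (r : V) (x : ExteriorAlgebra F V) :
    wedgeLeft r x = ExteriorAlgebra.ι F r * x := rfl

theorem ι_mul_swap (u v : V) (x : ExteriorAlgebra F V) :
    ExteriorAlgebra.ι F u * (ExteriorAlgebra.ι F v * x)
      = -(ExteriorAlgebra.ι F v * (ExteriorAlgebra.ι F u * x)) := by
  rw [← mul_assoc, ← mul_assoc, ← neg_mul]
  congr 1
  exact eq_neg_of_add_eq_zero_left (ExteriorAlgebra.ι_add_mul_swap u v)

theorem ι_mul_self (u : V) (x : ExteriorAlgebra F V) :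
    ExteriorAlgebra.ι F u * (ExteriorAlgebra.ι F u * x) = 0 := by
  rw [← mul_assoc, ExteriorAlgebra.ι_sq_zero, zero_mul]

theorem wedgePower_zero (U : Submodule F V) : wedgePower U 0 = 1 := pow_zero _

theorem wedgePower_succ (U : Submodule F V) (k : ℕ) :
    wedgePower U (k + 1) = U.map (ExteriorAlgebra.ι F) * wedgePower U k := pow_succ' _ _

theorem ι_mul_mem_wedgePower {U : Submodule F V} {k : ℕ} {u : V} {x : ExteriorAlgebra F V}
    (hu : u ∈ U) (hx : x ∈ wedgePower U k) :
    ExteriorAlgebra.ι F u * x ∈ wedgePower U (k + 1) := by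
  rw [wedgePower_succ]
  exact Submodule.mul_mem_mul (Submodule.mem_map_of_mem hu) hx

theorem wedgePower_succ_le {U : Submodule F V} {k : ℕ} {S : Submodule F (ExteriorAlgebra F V)}
    (h : ∀ u ∈ U, ∀ x ∈ wedgePower U k, ExteriorAlgebra.ι F u * x ∈ S) :
    wedgePower U (k + 1) ≤ S := by
  rw [wedgePower_succ, Submodule.mul_le]
  rintro _ ⟨u, hu, rfl⟩ x hx
  exact h u hu x hx

theorem wedgePower_mono {U W : Submodule F V} (h : U ≤ W) (k : ℕ) :
    wedgePower U k ≤ wedgePower W k := by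
  induction k with
  | zero => rw [wedgePower_zero, wedgePower_zero]
  | succ k ih => exact wedgePower_succ_le fun u hu x hx => ι_mul_mem_wedgePower (h hu) (ih hx)

theorem wedgePower_bot_succ (k : ℕ) : wedgePower (⊥ : Submodule F V) (k + 1) = ⊥ := by
  refine le_bot_iff.1 (wedgePower_succ_le fun u hu x _ => ?_)
  rw [(Submodule.mem_bot F).1 hu, map_zero, zero_mul]
  exact Submodule.zero_mem _

instance [FiniteDimensional F V] (U : Submodule F V) (k : ℕ) :
    FiniteDimensional F (wedgePower U k) := by
  rw [FiniteDimensional, Module.Finite.iff_fg]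
  exact Submodule.FG.pow (Submodule.FG.map _ (IsNoetherian.noetherian U)) k

/-- Anticommutation moves every r to the front, and two of them cancel. For k = 0 the truncated
exponent k - 1 only enlarges the right-hand side. -/
theorem wedgePower_sup_span_le (U : Submodule F V) (r : V) (k : ℕ) :
    wedgePower (U ⊔ F ∙ r) k ≤ wedgePower U k ⊔ (wedgePower U (k - 1)).map (wedgeLeft r) := by
  rcases k with _ | k
  · rw [wedgePower_zero, wedgePower_zero]; exact le_sup_left
  induction k with
  | zero =>
    refine wedgePower_succ_le fun w hw x hx => ?_
    obtain ⟨u, hu, z, hz, rfl⟩ := Submodule.mem_sup.1 hw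
    obtain ⟨c, rfl⟩ := Submodule.mem_span_singleton.1 hz
    rw [wedgePower_zero, ← wedgePower_zero U] at hx
    rw [map_add, map_smul, add_mul, smul_mul_assoc]
    exact Submodule.add_mem_sup (ι_mul_mem_wedgePower hu hx)
      (Submodule.smul_mem _ _ ⟨x, hx, rfl⟩)
  | succ k ih =>
    refine wedgePower_succ_le fun w hw x hx => ?_
    obtain ⟨u, hu, z, hz, rfl⟩ := Submodule.mem_sup.1 hw
    obtain ⟨c, rfl⟩ := Submodule.mem_span_singleton.1 hz
    obtain ⟨a, ha, b', hb', rfl⟩ := Submodule.mem_sup.1 (ih hx)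
    obtain ⟨b, hb, rfl⟩ := hb'
    rw [wedgeLeft_apply, map_add, map_smul]
    have e : (ExteriorAlgebra.ι F u + c • ExteriorAlgebra.ι F r) * (a + ExteriorAlgebra.ι F r * b)
        = ExteriorAlgebra.ι F u * a
          + (c • (ExteriorAlgebra.ι F r * a)
            - ExteriorAlgebra.ι F r * (ExteriorAlgebra.ι F u * b)) := by
      rw [add_mul, mul_add, mul_add, smul_mul_assoc, smul_mul_assoc, ι_mul_self,
        ι_mul_swap u r b, smul_zero]
      abel
    rw [e]
    exact Submodule.add_mem_sup (ι_mul_mem_wedgePower hu ha) (Submodule.sub_mem _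
      (Submodule.smul_mem _ _ ⟨a, ha, rfl⟩) ⟨_, ι_mul_mem_wedgePower hu hb, rfl⟩)

theorem wedgeLeft_mem_wedgePower_sup {U : Submodule F V} {r : V} {k : ℕ} {x : ExteriorAlgebra F V}
    (hx : x ∈ wedgePower U k) : wedgeLeft r x ∈ wedgePower (U ⊔ F ∙ r) (k + 1) :=
  ι_mul_mem_wedgePower (Submodule.mem_sup_right (Submodule.mem_span_singleton_self r))
    (wedgePower_mono le_sup_left k hx)

/-- Contraction of the exterior algebra by a linear functional. -/
noncomputable def wedgeContract (d : Module.Dual F V) :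
    ExteriorAlgebra F V →ₗ[F] ExteriorAlgebra F V :=
  CliffordAlgebra.contractLeft d

theorem wedgeContract_ι_mul (d : Module.Dual F V) (v : V) (x : ExteriorAlgebra F V) :
    wedgeContract d (ExteriorAlgebra.ι F v * x)
      = d v • x - ExteriorAlgebra.ι F v * wedgeContract d x :=
  CliffordAlgebra.contractLeft_ι_mul d v x

theorem wedgePower_le_ker_wedgeContract {U : Submodule F V} {d : Module.Dual F V}
    (hd : ∀ u ∈ U, d u = 0) (k : ℕ) : wedgePower U k ≤ LinearMap.ker (wedgeContract d) := by
  induction k with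
  | zero =>
    rw [wedgePower_zero, Submodule.one_le]
    exact CliffordAlgebra.contractLeft_one (Q := (0 : QuadraticForm F V)) (d := d)
  | succ k ih =>
    refine wedgePower_succ_le fun u hu x hx => ?_
    rw [LinearMap.mem_ker, wedgeContract_ι_mul, hd u hu, LinearMap.mem_ker.1 (ih hx), zero_smul,
      mul_zero, sub_zero]

theorem wedgeContract_add_wedgeLeft {d : Module.Dual F V} {r : V} (hr : d r = 1)
    {a b : ExteriorAlgebra F V} (ha : wedgeContract d a = 0) (hb : wedgeContract d b = 0) :
    wedgeContract d (a + wedgeLeft r b) = b := by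
  rw [map_add, ha, wedgeLeft_apply, wedgeContract_ι_mul, hb, hr, one_smul, mul_zero, sub_zero,
    zero_add]

/-- Contraction by d kills the parts free of r and strips r from the rest, so it reads off b. This
replaces a choice of basis of the exterior algebra. -/
theorem add_wedgeLeft_inj {d : Module.Dual F V} {r : V} (hr : d r = 1)
    {a b a' b' : ExteriorAlgebra F V} (ha : wedgeContract d a = 0) (hb : wedgeContract d b = 0)
    (ha' : wedgeContract d a' = 0) (hb' : wedgeContract d b' = 0)
    (h : a + wedgeLeft r b = a' + wedgeLeft r b') : a = a' ∧ b = b' := by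
  have hbb : b = b' := by
    rw [← wedgeContract_add_wedgeLeft hr ha hb, h, wedgeContract_add_wedgeLeft hr ha' hb']
  subst hbb
  exact ⟨add_right_cancel h, rfl⟩

theorem finrank_map_of_disjoint_ker {E E' : Type*} [AddCommGroup E] [Module F E] [AddCommGroup E']
    [Module F E'] (g : E →ₗ[F] E') (B : Submodule F E) (h : ∀ b ∈ B, g b = 0 → b = 0) :
    Module.finrank F (B.map g) = Module.finrank F B := by
  rw [← LinearMap.range_domRestrict]
  refine LinearMap.finrank_range_of_inj ?_
  rw [← LinearMap.ker_eq_bot, LinearMap.ker_eq_bot']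
  exact fun b hb => Subtype.ext (h b b.2 hb)

theorem finrank_map_add_finrank_inf_ker {E E' : Type*} [AddCommGroup E] [Module F E]
    [AddCommGroup E'] [Module F E'] (g : E →ₗ[F] E') (B : Submodule F E) [FiniteDimensional F B] :
    Module.finrank F (B.map g) + Module.finrank F ↥(B ⊓ LinearMap.ker g)
      = Module.finrank F B := by
  have := LinearMap.finrank_range_add_finrank_ker (g.domRestrict B)
  rw [LinearMap.range_domRestrict] at this
  rw [← this, LinearMap.ker_domRestrict, ← Submodule.finrank_map_subtype_eq,
    Submodule.map_comap_subtype]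

theorem finrank_sup_map_wedgeLeft {d : Module.Dual F V} {r : V} (hr : d r = 1)
    (A B : Submodule F (ExteriorAlgebra F V)) [FiniteDimensional F A] [FiniteDimensional F B]
    (hA : A ≤ LinearMap.ker (wedgeContract d)) (hB : B ≤ LinearMap.ker (wedgeContract d)) :
    Module.finrank F ↥(A ⊔ B.map (wedgeLeft r)) = Module.finrank F A + Module.finrank F B := by
  have hz : wedgeContract d (0 : ExteriorAlgebra F V) = 0 := map_zero _
  have h1 : A ⊓ B.map (wedgeLeft r) = ⊥ := by
    refine (Submodule.eq_bot_iff _).2 ?_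
    rintro x ⟨hx, b, hb, rfl⟩
    have := add_wedgeLeft_inj hr (hA hx) hz hz (hB hb) (by rw [map_zero, add_zero, zero_add])
    exact this.1
  have h2 : Module.finrank F (B.map (wedgeLeft r)) = Module.finrank F B := by
    refine finrank_map_of_disjoint_ker _ _ fun b hb h0 => ?_
    exact (add_wedgeLeft_inj hr hz (hB hb) hz hz (by rw [h0, map_zero])).2
  have := Submodule.finrank_sup_add_finrank_inf_eq A (B.map (wedgeLeft r))
  rw [h1, finrank_bot, add_zero, h2] at this
  exact this

/-- A vector outside a subspace is separated from it by a functional. -/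
theorem exists_dual_eq_one {U : Submodule F V} {r : V} (hr : r ∉ U) :
    ∃ d : Module.Dual F V, (∀ u ∈ U, d u = 0) ∧ d r = 1 := by
  obtain ⟨g, hg, hU⟩ := Submodule.exists_le_ker_of_notMem hr
  exact ⟨(g r)⁻¹ • g, fun u hu => by simp [LinearMap.mem_ker.1 (hU hu)], by simp [hg]⟩

end WedgePower

/-! ### Polar data and adjunction of radical vectors -/

/-- A reflexive sesquilinear form together with a notion of singular vector: the common features of
Hermitian, alternating and quadratic forms. -/
structure PolarData (F V : Type*) [Field F] [AddCommGroup V] [Module F V] where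
  σ : F →+* F
  invol : ∀ a, σ (σ a) = a
  h : V →ₛₗ[σ] V →ₗ[F] F
  refl : ∀ x y, h x y = 0 → h y x = 0
  sing : V → Prop
  sing_zero : sing 0
  sing_self : ∀ x, sing x → h x x = 0
  sing_add : ∀ x y, sing x → sing y → h x y = 0 → sing (x + y)
  sing_smul : ∀ (c : F) x, sing x → sing (c • x)
  exists_sing : ∀ x z, sing x → h x z ≠ 0 → ∃ c : F, sing (z + c • x)

namespace PolarData

variable {F V : Type*} [Field F] [AddCommGroup V] [Module F V] (D : PolarData F V)

/-- The subspaces consisting of pairwise orthogonal singular vectors. -/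
def IsTS (T : Submodule F V) : Prop :=
  ∀ x ∈ T, D.sing x ∧ ∀ y ∈ T, D.h x y = 0

/-- The subspace of the exterior algebra spanned by the `k`-th exterior powers of the totally
singular subspaces of `U`. -/
noncomputable def polarPower (U : Submodule F V) (k : ℕ) : Submodule F (ExteriorAlgebra F V) :=
  ⨆ (T : Submodule F V) (_ : T ≤ U) (_ : D.IsTS T), wedgePower T k

variable {D}

theorem wedgePower_le_polarPower {T U : Submodule F V} (hT : T ≤ U) (hs : D.IsTS T) (k : ℕ) :
    wedgePower T k ≤ D.polarPower U k :=
  le_iSup_of_le T (le_iSup_of_le hT (le_iSup_of_le hs le_rfl))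

theorem polarPower_le {U : Submodule F V} {k : ℕ} {S : Submodule F (ExteriorAlgebra F V)}
    (h : ∀ T ≤ U, D.IsTS T → wedgePower T k ≤ S) : D.polarPower U k ≤ S :=
  iSup_le fun T => iSup_le fun hT => iSup_le fun hs => h T hT hs

theorem polarPower_le_wedgePower (U : Submodule F V) (k : ℕ) :
    D.polarPower U k ≤ wedgePower U k :=
  polarPower_le fun _ hT _ => wedgePower_mono hT k

theorem polarPower_mono {U W : Submodule F V} (h : U ≤ W) (k : ℕ) :
    D.polarPower U k ≤ D.polarPower W k :=
  polarPower_le fun _ hT hs => wedgePower_le_polarPower (hT.trans h) hs k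

instance [FiniteDimensional F V] (U : Submodule F V) (k : ℕ) :
    FiniteDimensional F (D.polarPower U k) :=
  Submodule.finiteDimensional_of_le (polarPower_le_wedgePower U k)

theorem isTS_bot : D.IsTS ⊥ := by
  intro x hx
  rw [(Submodule.mem_bot F).1 hx]
  exact ⟨D.sing_zero, fun y _ => by rw [map_zero, LinearMap.zero_apply]⟩

theorem polarPower_zero (U : Submodule F V) : D.polarPower U 0 = 1 := by
  refine le_antisymm ?_ ?_
  · rw [← wedgePower_zero U]; exact polarPower_le_wedgePower U 0
  · rw [← wedgePower_zero (⊥ : Submodule F V)]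
    exact wedgePower_le_polarPower bot_le isTS_bot 0

theorem IsTS.mono {S T : Submodule F V} (hT : D.IsTS T) (h : S ≤ T) : D.IsTS S :=
  fun x hx => ⟨(hT x (h hx)).1, fun y hy => (hT x (h hx)).2 y (h hy)⟩

theorem IsTS.sup {S T : Submodule F V} (hS : D.IsTS S) (hT : D.IsTS T)
    (hST : ∀ s ∈ S, ∀ t ∈ T, D.h s t = 0) : D.IsTS (S ⊔ T) := by
  intro x hx
  obtain ⟨s, hs, t, ht, rfl⟩ := Submodule.mem_sup.1 hx
  refine ⟨D.sing_add s t (hS s hs).1 (hT t ht).1 (hST s hs t ht), fun y hy => ?_⟩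
  obtain ⟨s', hs', t', ht', rfl⟩ := Submodule.mem_sup.1 hy
  rw [D.h.map_add, LinearMap.add_apply, map_add, map_add, (hS s hs).2 s' hs', hST s hs t' ht',
    D.refl _ _ (hST s' hs' t ht), (hT t ht).2 t' ht']
  simp

theorem isTS_span_singleton {x : V} (hx : D.sing x) : D.IsTS (F ∙ x) := by
  intro y hy
  obtain ⟨c, rfl⟩ := Submodule.mem_span_singleton.1 hy
  refine ⟨D.sing_smul c x hx, fun z hz => ?_⟩
  obtain ⟨c', rfl⟩ := Submodule.mem_span_singleton.1 hz
  simp [D.sing_self x hx]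

/-- Since r is singular and orthogonal to U, a totally singular T may be enlarged by r, after which
it is generated by r and its intersection with U. -/
theorem polarPower_sup_span {U : Submodule F V} {r : V} (hr : D.sing r)
    (hrU : ∀ u ∈ U, D.h r u = 0) (k : ℕ) :
    D.polarPower (U ⊔ F ∙ r) (k + 1)
      = D.polarPower U (k + 1) ⊔ (D.polarPower U k).map (wedgeLeft r) := by
  have hspan : ∀ s ∈ F ∙ r, ∀ u ∈ U, D.h s u = 0 := by
    intro s hs u hu
    obtain ⟨c, rfl⟩ := Submodule.mem_span_singleton.1 hs
    simp [hrU u hu]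
  refine le_antisymm (polarPower_le fun T hT hs => ?_) (sup_le ?_ ?_)
  · have hS : D.IsTS (T ⊔ F ∙ r) := by
      refine hs.sup (isTS_span_singleton hr) fun t ht z hz => D.refl _ _ ?_
      obtain ⟨u, hu, w, hw, rfl⟩ := Submodule.mem_sup.1 (hT ht)
      rw [map_add, hspan z hz u hu, ((isTS_span_singleton hr) z hz).2 w hw, add_zero]
    have hle : T ≤ (T ⊔ F ∙ r) ⊓ U ⊔ F ∙ r := by
      intro t ht
      obtain ⟨u, hu, w, hw, rfl⟩ := Submodule.mem_sup.1 (hT ht)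
      refine Submodule.add_mem_sup ⟨?_, hu⟩ hw
      have := Submodule.sub_mem _ (Submodule.mem_sup_left (T := F ∙ r) ht)
        (Submodule.mem_sup_right (S := T) hw)
      rwa [add_sub_cancel_right] at this
    refine (wedgePower_mono hle _).trans ((wedgePower_sup_span_le _ r (k + 1)).trans ?_)
    exact sup_le_sup (wedgePower_le_polarPower inf_le_right (hS.mono inf_le_left) _)
      (Submodule.map_mono (wedgePower_le_polarPower inf_le_right (hS.mono inf_le_left) _))
  · exact polarPower_mono le_sup_left _
  · rw [Submodule.map_le_iff_le_comap]
    refine polarPower_le fun T hT hs x hx => ?_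
    refine wedgePower_le_polarPower (sup_le_sup_right hT _)
      (hs.sup (isTS_span_singleton hr) fun t ht z hz => D.refl _ _ (hspan z hz t (hT ht))) _
      (wedgeLeft_mem_wedgePower_sup hx)

theorem finrank_polarPower_zero (U : Submodule F V) :
    Module.finrank F (D.polarPower U 0) = 1 := by
  rw [polarPower_zero, Submodule.one_eq_span]
  exact finrank_span_singleton one_ne_zero

theorem finrank_polarPower_sup_span [FiniteDimensional F V] {U : Submodule F V} {r : V}
    (hr : D.sing r) (hrU : ∀ u ∈ U, D.h r u = 0) (hnr : r ∉ U) (k : ℕ) :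
    Module.finrank F (D.polarPower (U ⊔ F ∙ r) (k + 1))
      = Module.finrank F (D.polarPower U (k + 1)) + Module.finrank F (D.polarPower U k) := by
  obtain ⟨d, hd, hdr⟩ := exists_dual_eq_one hnr
  rw [polarPower_sup_span hr hrU]
  exact finrank_sup_map_wedgeLeft hdr _ _
    ((polarPower_le_wedgePower U _).trans (wedgePower_le_ker_wedgeContract hd _))
    ((polarPower_le_wedgePower U _).trans (wedgePower_le_ker_wedgeContract hd _))

end PolarData

/-- Pascal's rule in the form matching `finrank_polarPower_sup_span`, for a radical part growing by
one vector. -/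
theorem sum_antidiagonal_succ_choose (s k : ℕ) (f : ℕ → ℕ) :
    ∑ x ∈ Finset.HasAntidiagonal.antidiagonal (k + 1), (s + 1).choose x.1 * f x.2
      = ∑ x ∈ Finset.HasAntidiagonal.antidiagonal (k + 1), s.choose x.1 * f x.2
        + ∑ x ∈ Finset.HasAntidiagonal.antidiagonal k, s.choose x.1 * f x.2 := by
  rw [Finset.Nat.antidiagonal_succ]
  simp only [Finset.sum_cons, Finset.sum_map, Function.Embedding.prodMap,
    Function.Embedding.coeFn_mk, Prod.map, Function.Embedding.refl_apply, Nat.succ_eq_add_one, Nat.choose_succ_succ, add_mul,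
    Finset.sum_add_distrib, Nat.choose_zero_right]
  ring

theorem exists_finrank_eq_of_finrank_eq_succ {F V : Type*} [Field F] [AddCommGroup V] [Module F V]
    [FiniteDimensional F V] {S : Submodule F V} {s : ℕ} (hs : Module.finrank F S = s + 1) :
    ∃ (S' : Submodule F V) (r : V), r ∉ S' ∧ S = S' ⊔ F ∙ r ∧ Module.finrank F S' = s := by
  have hS : S ≠ ⊥ := by rintro rfl; simp at hs
  obtain ⟨r, hr, hr0⟩ := Submodule.exists_mem_ne_zero_of_ne_bot hS
  obtain ⟨C, hC⟩ := Submodule.exists_isCompl (F ∙ r)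
  have hle : F ∙ r ≤ S := (Submodule.span_singleton_le_iff_mem r S).2 hr
  have hsup : S = C ⊓ S ⊔ F ∙ r := by
    rw [sup_comm, ← sup_inf_assoc_of_le C hle, hC.sup_eq_top, top_inf_eq]
  have hinf : (C ⊓ S) ⊓ F ∙ r = ⊥ :=
    le_bot_iff.1 ((inf_le_inf_right _ inf_le_left).trans hC.symm.disjoint.le_bot)
  refine ⟨C ⊓ S, r, fun h => hr0 ?_, hsup, ?_⟩
  · exact (Submodule.mem_bot F).1 (hinf ▸ ⟨h, Submodule.mem_span_singleton_self r⟩)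
  · have := Submodule.finrank_sup_add_finrank_inf_eq (C ⊓ S) (F ∙ r)
    rw [← hsup, hinf, finrank_bot, hs, finrank_span_singleton hr0] at this
    omega

namespace PolarData

variable {F V : Type*} [Field F] [AddCommGroup V] [Module F V] {D : PolarData F V}

/-- The vectors of S are split off one at a time; the binomial coefficient counts the dimension of
the power of S. -/
theorem finrank_polarPower_sup [FiniteDimensional F V] {U S : Submodule F V} (hS : D.IsTS S)
    (hSU : ∀ s ∈ S, ∀ u ∈ U, D.h s u = 0) (hd : Disjoint U S) (k : ℕ) :
    Module.finrank F (D.polarPower (U ⊔ S) k)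
      = ∑ x ∈ Finset.HasAntidiagonal.antidiagonal k,
          (Module.finrank F S).choose x.1 * Module.finrank F (D.polarPower U x.2) := by
  obtain ⟨s, hs⟩ : ∃ s, Module.finrank F S = s := ⟨_, rfl⟩
  rw [hs]
  induction s generalizing S k with
  | zero =>
    rw [Submodule.finrank_eq_zero.1 hs, sup_bot_eq]
    rcases k with _ | k
    · simp
    · rw [Finset.Nat.antidiagonal_succ]
      simp
  | succ s ih =>
    obtain ⟨S', r, hr, rfl, hs'⟩ := exists_finrank_eq_of_finrank_eq_succ hs
    have hrS : r ∈ S' ⊔ F ∙ r := Submodule.mem_sup_right (Submodule.mem_span_singleton_self r)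
    rcases k with _ | k
    · simp [finrank_polarPower_zero]
    have hrU : ∀ u ∈ U ⊔ S', D.h r u = 0 := by
      intro u hu
      obtain ⟨v, hv, w, hw, rfl⟩ := Submodule.mem_sup.1 hu
      rw [map_add, hSU r hrS v hv, (hS r hrS).2 w (Submodule.mem_sup_left hw), add_zero]
    have hnr : r ∉ U ⊔ S' := by
      intro h
      obtain ⟨v, hv, w, hw, e⟩ := Submodule.mem_sup.1 h
      have hv0 : v = 0 := by
        refine Submodule.disjoint_def.1 hd v hv ?_
        rw [eq_sub_of_add_eq e]
        exact Submodule.sub_mem _ hrS (Submodule.mem_sup_left hw)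
      rw [hv0, zero_add] at e
      exact hr (e ▸ hw)
    have h1 := fun k => ih (S := S') (k := k) (hS.mono le_sup_left)
      (fun s hs => hSU s (Submodule.mem_sup_left hs)) (hd.mono_right le_sup_left) hs'
    rw [← sup_assoc, finrank_polarPower_sup_span (hS r hrS).1 hrU hnr, h1, h1]
    exact (sum_antidiagonal_succ_choose s k fun j => Module.finrank F (D.polarPower U j)).symm

/-- The zero form, for which all vectors are singular. -/
noncomputable def zero (F V : Type*) [Field F] [AddCommGroup V] [Module F V] : PolarData F V where
  σ := RingHom.id F
  invol _ := rfl
  h := 0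
  refl _ _ _ := rfl
  sing _ := True
  sing_zero := trivial
  sing_self _ _ := rfl
  sing_add _ _ _ _ _ := trivial
  sing_smul _ _ _ := trivial
  exists_sing _ _ _ _ := ⟨0, trivial⟩

theorem isTS_zero (T : Submodule F V) : (zero F V).IsTS T := fun _ _ => ⟨trivial, fun _ _ => rfl⟩

theorem polarPower_eq_of_isTS {U : Submodule F V} (hU : D.IsTS U) (k : ℕ) :
    D.polarPower U k = wedgePower U k :=
  le_antisymm (polarPower_le_wedgePower U k) (wedgePower_le_polarPower le_rfl hU k)

end PolarData

/-- For the zero form every subspace is totally singular, so this is `finrank_polarPower_sup` over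
the zero subspace. -/
theorem finrank_wedgePower {F V : Type*} [Field F] [AddCommGroup V] [Module F V]
    [FiniteDimensional F V] (U : Submodule F V) (k : ℕ) :
    Module.finrank F (wedgePower U k) = (Module.finrank F U).choose k := by
  have h := PolarData.finrank_polarPower_sup (D := PolarData.zero F V) (U := ⊥) (S := U)
    (PolarData.isTS_zero U) (fun _ _ _ _ => rfl) disjoint_bot_left k
  rw [bot_sup_eq, PolarData.polarPower_eq_of_isTS (PolarData.isTS_zero U)] at h
  rw [h, Finset.sum_eq_single (k, 0)]
  · simp [PolarData.finrank_polarPower_zero]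
  · rintro ⟨i, j⟩ hij hne
    rw [Finset.HasAntidiagonal.mem_antidiagonal] at hij
    rcases j with _ | j
    · exact absurd (by simp at hij; simp [hij]) hne
    · rw [PolarData.polarPower_eq_of_isTS (PolarData.isTS_zero _), wedgePower_bot_succ]
      simp
  · simp

/-! ### Orthogonality, hyperbolic pairs and spans of singular vectors -/

namespace PolarData

variable {F V : Type*} [Field F] [AddCommGroup V] [Module F V] (D : PolarData F V)

/-- The subspace orthogonal to `Y`. -/
def perp (Y : Submodule F V) : Submodule F V where
  carrier := {v | ∀ y ∈ Y, D.h y v = 0}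
  add_mem' ha hb y hy := by rw [map_add, ha y hy, hb y hy, add_zero]
  zero_mem' y _ := map_zero _
  smul_mem' c v hv y hy := by rw [map_smul, hv y hy, smul_zero]

variable {D}

theorem mem_perp_sup {Y Z : Submodule F V} {v : V} :
    v ∈ D.perp (Y ⊔ Z) ↔ v ∈ D.perp Y ∧ v ∈ D.perp Z := by
  refine ⟨fun h => ⟨fun y hy => h y (Submodule.mem_sup_left hy),
    fun y hy => h y (Submodule.mem_sup_right hy)⟩, fun h y hy => ?_⟩
  obtain ⟨a, ha, b, hb, rfl⟩ := Submodule.mem_sup.1 hy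
  rw [D.h.map_add, LinearMap.add_apply, h.1 a ha, h.2 b hb, add_zero]

theorem mem_perp_span {S : Set V} {v : V} :
    v ∈ D.perp (Submodule.span F S) ↔ ∀ y ∈ S, D.h y v = 0 := by
  refine ⟨fun h y hy => h y (Submodule.subset_span hy), fun h y hy => ?_⟩
  refine D.refl _ _ ?_
  rw [← LinearMap.mem_ker]
  exact Submodule.span_le.2 (fun y hy => LinearMap.mem_ker.2 (D.refl _ _ (h y hy))) hy

theorem mem_perp_span_singleton {r v : V} : v ∈ D.perp (F ∙ r) ↔ D.h r v = 0 := by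
  rw [mem_perp_span]
  simp

/-- A subspace `Y` of dimension smaller than that of a totally singular subspace `M` of `U` which
meets the radical of `U` trivially is orthogonal to a non-orthogonal pair of vectors of `U`, the
first of which is in `M`. -/
theorem exists_hyperbolic [FiniteDimensional F V] {U M Y : Submodule F V} (hMU : M ≤ U)
    (hM : D.IsTS M) (hMn : ∀ x ∈ M, (∀ u ∈ U, D.h x u = 0) → x = 0)
    (hY : Module.finrank F Y < Module.finrank F M) :
    ∃ x ∈ M ⊓ D.perp Y, ∃ z ∈ U ⊓ D.perp Y, D.h x z ≠ 0 := by
  by_contra! hcon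
  -- Let Φ be the span of the functionals h(y, ·) on U for y in Y, and let ρ be restriction to M.
  -- Then P = M ∩ Y^⊥ has dimension dim M - dim ρ(Φ). If P is orthogonal to U ∩ Y^⊥, the functionals
  -- h(x, ·) with x in P lie in Φ; they vanish on M and are independent, so dim P ≤ dim Φ - dim
  -- ρ(Φ). Hence dim M ≤ dim Φ ≤ dim Y.
  refine hY.not_ge ?_
  let yb := Module.finBasis F Y
  let L : Fin (Module.finrank F Y) → Module.Dual F U := fun i => (D.h (yb i)).domRestrict U
  let Φ : Submodule F (Module.Dual F U) := Submodule.span F (Set.range L)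
  let ρ : Module.Dual F U →ₗ[F] Module.Dual F M := Module.Dual.transpose (Submodule.inclusion hMU)
  have hρ : ∀ (f : Module.Dual F U) (m : M), ρ f m = f ⟨m, hMU m.2⟩ := fun _ _ => rfl
  have hperp : ∀ v : V, (∀ i, D.h (yb i) v = 0) → v ∈ D.perp Y := by
    intro v hv
    have e : Y = Submodule.span F (Set.range fun i => (yb i : V)) := by
      have := congrArg (Submodule.map Y.subtype) yb.span_eq
      rw [Submodule.map_span, Submodule.map_subtype_top, ← Set.range_comp] at this
      exact this.symm
    rw [e, mem_perp_span]
    rintro _ ⟨i, rfl⟩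
    exact hv i
  let P : Submodule F M := (Φ.map ρ).dualCoannihilator
  have hP : ∀ x ∈ P, (x : V) ∈ D.perp Y := by
    intro x hx
    refine hperp _ fun i => ?_
    have := (Submodule.mem_dualCoannihilator _).1 hx (ρ (L i))
      (Submodule.mem_map_of_mem (Submodule.subset_span ⟨i, rfl⟩))
    exact this
  let xb := Module.finBasis F P
  let X : Fin (Module.finrank F P) → Module.Dual F U := fun i => (D.h (xb i : M)).domRestrict U
  have hX : LinearIndependent F X := by
    rw [Fintype.linearIndependent_iff]
    intro g hg i
    -- The form is σ-semilinear on the left, so twisting the coefficients by σ produces the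
    -- functional with coefficients g.
    have h0 : (∑ i, D.σ (g i) • xb i : P) = 0 := by
      have : ((∑ i, D.σ (g i) • xb i : P) : V) = 0 := by
        refine hMn _ (Subtype.prop _) fun u hu => ?_
        have := LinearMap.congr_fun hg ⟨u, hu⟩
        simp only [X, LinearMap.sum_apply, LinearMap.smul_apply, LinearMap.domRestrict_apply,
          LinearMap.zero_apply] at this
        simp only [Submodule.coe_sum, Submodule.coe_smul, map_sum, LinearMap.sum_apply,
          LinearMap.map_smulₛₗ, LinearMap.smul_apply, D.invol]
        exact this
      exact Subtype.ext (Subtype.ext this)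
    have := Fintype.linearIndependent_iff.1 xb.linearIndependent _ h0 i
    exact (map_eq_zero D.σ).1 this
  have hXΦ : Submodule.span F (Set.range X) ≤ Φ ⊓ LinearMap.ker ρ := by
    rw [Submodule.span_le]
    rintro _ ⟨i, rfl⟩
    refine ⟨mem_span_of_iInf_ker_le_ker fun u hu => ?_, LinearMap.mem_ker.2 ?_⟩
    · refine hcon _ ⟨Subtype.prop _, hP _ (Subtype.prop _)⟩ u ⟨u.2, hperp _ fun j => ?_⟩
      exact LinearMap.mem_ker.1 ((Submodule.mem_iInf _).1 hu j)
    · ext m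
      exact (hM _ (Subtype.prop _)).2 m m.2
  have h1 : Module.finrank F Φ ≤ Module.finrank F Y :=
    (finrank_range_le_card (R := F) L).trans_eq (Fintype.card_fin _)
  have h2 := Subspace.finrank_add_finrank_dualCoannihilator_eq (Φ.map ρ)
  have h3 : Module.finrank F P ≤ Module.finrank F ↥(Φ ⊓ LinearMap.ker ρ) := by
    have := Submodule.finrank_mono hXΦ
    rwa [finrank_span_eq_card hX, Fintype.card_fin] at this
  have h4 : Module.finrank F ↥(Φ.map ρ) + Module.finrank F ↥(Φ ⊓ LinearMap.ker ρ)
      = Module.finrank F Φ := finrank_map_add_finrank_inf_ker ρ Φ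
  change _ + Module.finrank F P = _ at h2
  omega

/-- A vector not orthogonal to x becomes singular after adding a multiple of x; a vector orthogonal
to x is the difference of two that are not, namely v + z and z. -/
theorem le_span_sing {Z : Submodule F V} {x z : V} (hx : D.sing x) (hxZ : x ∈ Z) (hz : z ∈ Z)
    (hxz : D.h x z ≠ 0) : Z ≤ Submodule.span F {s | D.sing s ∧ s ∈ Z} := by
  have key : ∀ v ∈ Z, D.h x v ≠ 0 → v ∈ Submodule.span F {s | D.sing s ∧ s ∈ Z} := by
    intro v hv hxv
    obtain ⟨c, hc⟩ := D.exists_sing x v hx hxv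
    rw [← add_sub_cancel_right v (c • x)]
    exact Submodule.sub_mem _
      (Submodule.subset_span ⟨hc, Submodule.add_mem _ hv (Submodule.smul_mem _ _ hxZ)⟩)
      (Submodule.smul_mem _ _ (Submodule.subset_span ⟨hx, hxZ⟩))
  intro v hv
  by_cases hxv : D.h x v = 0
  · rw [← add_sub_cancel_right v z]
    refine Submodule.sub_mem _ (key _ (Submodule.add_mem _ hv hz) ?_) (key _ hz hxz)
    rwa [map_add, hxv, zero_add]
  · exact key v hv hxv

theorem inf_perp_le_span_sing [FiniteDimensional F V] {U M Y : Submodule F V} (hMU : M ≤ U)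
    (hM : D.IsTS M) (hMn : ∀ x ∈ M, (∀ u ∈ U, D.h x u = 0) → x = 0)
    (hY : Module.finrank F Y < Module.finrank F M) :
    U ⊓ D.perp Y ≤ Submodule.span F {s | D.sing s ∧ s ∈ U ⊓ D.perp Y} := by
  obtain ⟨x, hx, z, hz, hxz⟩ := exists_hyperbolic hMU hM hMn hY
  exact le_span_sing (hM x hx.1).1 ⟨hMU hx.1, hx.2⟩ hz hxz

end PolarData

/-! ### Replacing factors of a product by singular vectors -/

section

variable {F V : Type*} [Field F] [AddCommGroup V] [Module F V]

theorem mul_ι_mem_wedgePower_sup {X : Submodule F V} {p : ℕ} {x : ExteriorAlgebra F V} (s : V)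
    (hx : x ∈ wedgePower X p) :
    x * ExteriorAlgebra.ι F s ∈ wedgePower (X ⊔ F ∙ s) (p + 1) := by
  rw [wedgePower, pow_succ]
  exact Submodule.mul_mem_mul (wedgePower_mono le_sup_left p hx)
    (Submodule.mem_map_of_mem (Submodule.mem_sup_right (Submodule.mem_span_singleton_self s)))

theorem finrank_sup_span_singleton_le [FiniteDimensional F V] (X : Submodule F V) (s : V) :
    Module.finrank F ↥(X ⊔ F ∙ s) ≤ Module.finrank F X + 1 :=
  (Submodule.finrank_add_le_finrank_add_finrank _ _).trans
    (Nat.add_le_add_left (by simpa using finrank_span_le_card (R := F) ({s} : Set V)) _)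

/-- The `k`-th power is generated by the powers of subspaces of dimension at most `k`. -/
theorem wedgePower_le_of_finrank_le [FiniteDimensional F V] {T : Submodule F V} {k : ℕ}
    {S : Submodule F (ExteriorAlgebra F V)}
    (h : ∀ T' ≤ T, Module.finrank F T' ≤ k → wedgePower T' k ≤ S) : wedgePower T k ≤ S := by
  suffices H : ∀ k, wedgePower T k
      ≤ ⨆ (T' : Submodule F V) (_ : T' ≤ T ∧ Module.finrank F T' ≤ k), wedgePower T' k from
    (H k).trans (iSup_le fun T' => iSup_le fun hT' => h T' hT'.1 hT'.2)
  intro k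
  induction k with
  | zero =>
    refine le_iSup_of_le ⊥ (le_iSup_of_le ⟨bot_le, by simp⟩ ?_)
    rw [wedgePower_zero, wedgePower_zero]
  | succ k ih =>
    refine wedgePower_succ_le fun u hu x hx => ?_
    rw [← wedgeLeft_apply, ← Submodule.mem_comap]
    refine SetLike.le_def.1 ?_ (ih hx)
    refine iSup_le fun T' => iSup_le fun hT' y hy => ?_
    refine Submodule.mem_iSup_of_mem (T' ⊔ F ∙ u) (Submodule.mem_iSup_of_mem ⟨?_, ?_⟩
      (wedgeLeft_mem_wedgePower_sup hy))
    · exact sup_le hT'.1 ((Submodule.span_singleton_le_iff_mem u T).2 hu)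
    · exact (finrank_sup_span_singleton_le _ _).trans (Nat.add_le_add_right hT'.2 1)

end

namespace PolarData

variable {F V : Type*} [Field F] [AddCommGroup V] [Module F V] {D : PolarData F V}

theorem mul_mem_polarPower_of_mem_zero {U X W : Submodule F V} (hX : D.IsTS X) (hXU : X ≤ U) {p : ℕ}
    {x w : ExteriorAlgebra F V} (hx : x ∈ wedgePower X p) (hw : w ∈ wedgePower W 0) :
    x * w ∈ D.polarPower U p := by
  rw [wedgePower_zero, Submodule.one_eq_span] at hw
  obtain ⟨c, rfl⟩ := Submodule.mem_span_singleton.1 hw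
  rw [mul_smul_comm, mul_one]
  exact Submodule.smul_mem _ _ (wedgePower_le_polarPower hXU hX _ hx)

theorem IsTS.sup_span {X : Submodule F V} (hX : D.IsTS X) {s : V} (hs : D.sing s)
    (hsX : s ∈ D.perp X) : D.IsTS (X ⊔ F ∙ s) := by
  refine hX.sup (isTS_span_singleton hs) fun x hx z hz => ?_
  obtain ⟨c, rfl⟩ := Submodule.mem_span_singleton.1 hz
  rw [map_smul, hsX x hx, smul_zero]

/-- If the first factor of a product can be taken in a set of singular vectors, it can be taken
arbitrarily in its span. -/
theorem mul_ι_mul_mem_of_sing {Z : Submodule F V} {S : Submodule F (ExteriorAlgebra F V)}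
    (hZ : Z ≤ Submodule.span F {s | D.sing s ∧ s ∈ Z}) (x w : ExteriorAlgebra F V)
    (h : ∀ s ∈ Z, D.sing s → x * (ExteriorAlgebra.ι F s * w) ∈ S) {v : V} (hv : v ∈ Z) :
    x * (ExteriorAlgebra.ι F v * w) ∈ S := by
  let g : V →ₗ[F] ExteriorAlgebra F V :=
    LinearMap.mulLeft F x ∘ₗ LinearMap.mulRight F w ∘ₗ ExteriorAlgebra.ι F
  have : Submodule.span F {s | D.sing s ∧ s ∈ Z} ≤ S.comap g :=
    Submodule.span_le.2 fun s hs => h s hs.2 hs.1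
  exact this (hZ hv)

/-- Write W = W' + ⟨v⟩. The vector v lies in U ∩ (X + W')^⊥, which is spanned by singular vectors
while dim (X + W') < dim M. Replacing v by one of these moves a factor from W to X. -/
theorem mul_mem_polarPower_of_isotropic [FiniteDimensional F V] {U M : Submodule F V} (hMU : M ≤ U)
    (hM : D.IsTS M) (hMn : ∀ x ∈ M, (∀ u ∈ U, D.h x u = 0) → x = 0) (i : ℕ) :
    ∀ (p : ℕ) (X W : Submodule F V), D.IsTS X → X ≤ U → W ≤ U →
      (∀ x ∈ W, ∀ y ∈ W, D.h x y = 0) → (∀ x ∈ X, ∀ w ∈ W, D.h x w = 0) →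
      Module.finrank F X ≤ p → Module.finrank F W ≤ i → p + i ≤ Module.finrank F M →
      ∀ x ∈ wedgePower X p, ∀ w ∈ wedgePower W i, x * w ∈ D.polarPower U (p + i) := by
  induction i with
  | zero =>
    intro p X W hX hXU _ _ _ _ _ _ x hx w hw
    exact mul_mem_polarPower_of_mem_zero hX hXU hx hw
  | succ i ih =>
    intro p X W hX hXU hWU hWW hXW hp hi hpi x hx w hw
    rcases Nat.lt_or_eq_of_le hi with hlt | heq
    · have : wedgePower W (i + 1) = ⊥ := by
        rw [← Submodule.finrank_eq_zero (R := F), finrank_wedgePower, Nat.choose_eq_zero_of_lt hlt]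
      rw [this, Submodule.mem_bot] at hw
      rw [hw, mul_zero]
      exact Submodule.zero_mem _
    obtain ⟨W', v, _, rfl, hW'⟩ := exists_finrank_eq_of_finrank_eq_succ heq
    have hvW : v ∈ W' ⊔ F ∙ v := Submodule.mem_sup_right (Submodule.mem_span_singleton_self v)
    obtain ⟨a, ha, b', ⟨b, hb, rfl⟩, rfl⟩ :=
      Submodule.mem_sup.1 (wedgePower_sup_span_le W' v (i + 1) hw)
    -- W' has dimension i, so its power of exponent i + 1 vanishes and only the part divisible by v
    -- remains.
    have ha0 : a = 0 := by
      have : wedgePower W' (i + 1) = ⊥ := by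
        rw [← Submodule.finrank_eq_zero (R := F), finrank_wedgePower,
          Nat.choose_eq_zero_of_lt (by omega)]
      rwa [this, Submodule.mem_bot] at ha
    rw [ha0, zero_add, wedgeLeft_apply]
    have hfin : Module.finrank F ↥(X ⊔ W') < Module.finrank F M := by
      have := Submodule.finrank_add_le_finrank_add_finrank X W'
      omega
    refine mul_ι_mul_mem_of_sing (inf_perp_le_span_sing hMU hM hMn hfin) x b ?_
      (v := v) ⟨hWU hvW, mem_perp_sup.2 ⟨fun y hy => hXW y hy v hvW,
        fun y hy => hWW y (Submodule.mem_sup_left hy) v hvW⟩⟩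
    intro s hs hsing
    obtain ⟨hsX, hsW⟩ := mem_perp_sup.1 hs.2
    rw [← mul_assoc, show p + (i + 1) = p + 1 + i by omega]
    refine ih (p + 1) (X ⊔ F ∙ s) W' (hX.sup_span hsing hsX) (sup_le hXU
      ((Submodule.span_singleton_le_iff_mem s U).2 hs.1)) (le_sup_left.trans hWU)
      (fun x hx y hy => hWW x (Submodule.mem_sup_left hx) y (Submodule.mem_sup_left hy)) ?_
      ((finrank_sup_span_singleton_le _ _).trans (by omega)) hW'.le (by omega) _
      (mul_ι_mem_wedgePower_sup s hx) b hb
    intro y hy w hw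
    have : w ∈ D.perp (X ⊔ F ∙ s) := mem_perp_sup.2 ⟨fun x hx => hXW x hx w
      (Submodule.mem_sup_left hw), mem_perp_span_singleton.2 (D.refl _ _ (hsW w hw))⟩
    exact this y hy

/-- Below the Witt index, the powers of totally isotropic subspaces are generated by those of
totally singular subspaces. -/
theorem wedgePower_le_polarPower_of_isotropic [FiniteDimensional F V] {U M : Submodule F V}
    (hMU : M ≤ U) (hM : D.IsTS M) (hMn : ∀ x ∈ M, (∀ u ∈ U, D.h x u = 0) → x = 0) {k : ℕ}
    (hk : k ≤ Module.finrank F M) {T : Submodule F V} (hTU : T ≤ U)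
    (hT : ∀ x ∈ T, ∀ y ∈ T, D.h x y = 0) : wedgePower T k ≤ D.polarPower U k := by
  refine wedgePower_le_of_finrank_le fun T' hT' hfin x hx => ?_
  have := mul_mem_polarPower_of_isotropic hMU hM hMn k 0 ⊥ T' isTS_bot bot_le (hT'.trans hTU)
    (fun x hx y hy => hT x (hT' hx) y (hT' hy))
    (fun x hx w _ => by rw [(Submodule.mem_bot F).1 hx, map_zero, LinearMap.zero_apply])
    (by simp) hfin (by omega) 1 (by rw [wedgePower_zero]; exact Submodule.one_le.1 le_rfl) x hx
  rwa [one_mul, Nat.zero_add] at this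

/-! ### Hermitian forms, and symmetric forms with 2 ≠ 0 -/

section Full

/-- Modulo S, expand ω(s + te, σ(t)v - f). Its arguments are orthogonal because h(e,f) = h(s,v), and
the cross terms ω(s,f) and ω(e,v) already lie in S. -/
theorem smul_sub_smul_mem {E : Type*} [AddCommGroup E] [Module F E] {S : Submodule F E}
    {L L' : Submodule F V} (hLL : L ≤ L') (ω : V →ₗ[F] V →ₗ[F] E)
    (hω : ∀ z ∈ L, ∀ w ∈ L', D.sing z → D.h z w = 0 → ω z w ∈ S) {s v e f : V}
    (hs : s ∈ L) (hv : v ∈ L') (he : e ∈ L) (hf : f ∈ L) (hss : D.sing s) (hes : D.sing e)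
    (hse : D.h s e = 0) (hsf : D.h s f = 0) (hev : D.h e v = 0) (hef : D.h e f = D.h s v) (t : F) :
    D.σ t • ω s v - t • ω e f ∈ S := by
  have h1 : ω s f ∈ S := hω s hs f (hLL hf) hss hsf
  have h2 : ω e v ∈ S := hω e he v hv hes hev
  have h3 : ω (s + t • e) (D.σ t • v - f) ∈ S := by
    refine hω _ (Submodule.add_mem _ hs (Submodule.smul_mem _ _ he)) _
      (Submodule.sub_mem _ (Submodule.smul_mem _ _ hv) (hLL hf))
      (D.sing_add _ _ hss (D.sing_smul _ _ hes) (by rw [map_smul, hse, smul_zero])) ?_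
    rw [D.h.map_add, LinearMap.add_apply, LinearMap.map_smulₛₗ, LinearMap.smul_apply, map_sub,
      map_sub, map_smul, map_smul, hsf, hev, hef, smul_zero, sub_zero, zero_sub, smul_neg,
      add_neg_cancel]
  have e1 : D.σ t • ω s v - t • ω e f
      = ω (s + t • e) (D.σ t • v - f) + ω s f - (t * D.σ t) • ω e v := by
    simp only [map_add, map_sub, map_smul, LinearMap.add_apply, LinearMap.smul_apply]
    module
  rw [e1]
  exact Submodule.sub_mem _ (Submodule.add_mem _ h3 h1) (Submodule.smul_mem _ _ h2)

/-- The pair e, f is first normalized so that `smul_sub_smul_mem` applies; two instances of the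
resulting congruence then isolate ω(s,v). -/
theorem mem_of_hyperbolic {E : Type*} [AddCommGroup E] [Module F E] {S : Submodule F E}
    (hk : (∃ t, D.σ t ≠ t) ∨ ((2 : F) ≠ 0 ∧ ∀ x y, D.h x y = D.h y x))
    {L L' : Submodule F V} (hLL : L ≤ L') (ω : V →ₗ[F] V →ₗ[F] E) (hω0 : ∀ v, ω v v = 0)
    (hω : ∀ z ∈ L, ∀ w ∈ L', D.sing z → D.h z w = 0 → ω z w ∈ S) {s v e f : V}
    (hs : s ∈ L) (hv : v ∈ L') (he : e ∈ L) (hf : f ∈ L) (hss : D.sing s) (hes : D.sing e)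
    (hse : D.h s e = 0) (hsf : D.h s f = 0) (hef : D.h e f ≠ 0) (hsv : D.h s v ≠ 0) :
    ω s v ∈ S := by
  -- Since h(s,v) ≠ 0, a multiple of s corrects g to be orthogonal to v, without affecting
  -- singularity or orthogonality to s.
  have adjust : ∀ g ∈ L, D.sing g → D.h s g = 0 → ∃ c : F, g + c • s ∈ L ∧ D.sing (g + c • s) ∧
      D.h s (g + c • s) = 0 ∧ D.h (g + c • s) v = 0 := by
    intro g hg hgs hsg
    refine ⟨-D.σ (D.h g v / D.h s v), Submodule.add_mem _ hg (Submodule.smul_mem _ _ hs),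
      D.sing_add _ _ hgs (D.sing_smul _ _ hss) ?_, ?_, ?_⟩
    · rw [map_smul, D.refl _ _ hsg, smul_zero]
    · rw [map_add, map_smul, hsg, D.sing_self s hss, smul_zero, add_zero]
    · rw [D.h.map_add, LinearMap.add_apply, LinearMap.map_smulₛₗ, LinearMap.smul_apply, map_neg,
        D.invol, smul_eq_mul, neg_mul, div_mul_cancel₀ _ hsv, add_neg_cancel]
  obtain ⟨c, he', hes', hse', hev'⟩ := adjust e he hes hse
  set e' := e + c • s with he'_def
  have hef' : D.h e' f ≠ 0 := by
    rw [he'_def, D.h.map_add, LinearMap.add_apply, LinearMap.map_smulₛₗ, LinearMap.smul_apply, hsf,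
      smul_zero, add_zero]
    exact hef
  -- Singularity of f' and its orthogonality to v matter only when e' and f' exchange roles below.
  obtain ⟨c₁, hfs⟩ := D.exists_sing e' f hes' hef'
  have hf1 : f + c₁ • e' ∈ L := Submodule.add_mem _ hf (Submodule.smul_mem _ _ he')
  obtain ⟨c₂, hf', hfs', hsf', hfv'⟩ := adjust _ hf1 hfs
    (by rw [map_add, map_smul, hsf, hse', smul_zero, add_zero])
  set f' := f + c₁ • e' + c₂ • s with hf'_def
  have hef'' : D.h e' f' = D.h e' f := by
    rw [hf'_def, map_add, map_add, map_smul, map_smul, D.sing_self _ hes', D.refl _ _ hse',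
      smul_zero, smul_zero, add_zero, add_zero]
  set a := D.h s v / D.h e' f with ha
  have ha' : D.h e' (a • f') = D.h s v := by
    rw [map_smul, hef'', smul_eq_mul, ha, div_mul_cancel₀ _ hef']
  have key := smul_sub_smul_mem hLL ω hω hs hv he' (Submodule.smul_mem L a hf') hss hes' hse'
    (by rw [map_smul, hsf', smul_zero]) hev' ha'
  rcases hk with ⟨t, ht⟩ | ⟨h2, hsymm⟩
  -- Subtracting t times the congruence for 1 from the one for t leaves (σ(t) - t) ω(s,v).
  · have h1 := key 1
    rw [map_one, one_smul, one_smul] at h1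
    have h3 : (D.σ t - t) • ω s v ∈ S := by
      have := Submodule.sub_mem _ (key t) (Submodule.smul_mem _ t h1)
      rw [smul_sub, sub_sub_sub_cancel_right, ← sub_smul] at this
      exact this
    exact (Submodule.smul_mem_iff _ (sub_ne_zero.2 ht)).1 h3
  -- With the pair exchanged, ω(s,v) is congruent to both ω(e',af') and its negative, so twice
  -- ω(s,v) lies in S.
  · have h1 := key 1
    have h3 := smul_sub_smul_mem hLL ω hω hs hv (Submodule.smul_mem L a hf') he' hss
      (D.sing_smul a _ hfs') (by rw [map_smul, hsf', smul_zero]) hse'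
      (by rw [LinearMap.map_smulₛₗ, LinearMap.smul_apply, hfv', smul_zero])
      (by rw [hsymm, ha']) 1
    rw [map_one, one_smul, one_smul] at h1 h3
    have h4 : ω e' (a • f') + ω (a • f') e' = 0 := by
      have := hω0 (e' + a • f')
      simpa [hω0] using this
    have h5 : (2 : F) • ω s v ∈ S := by
      have := Submodule.add_mem _ h1 h3
      rw [sub_add_sub_comm, h4, sub_zero, ← two_smul F] at this
      exact this
    exact (Submodule.smul_mem_iff _ h2).1 h5

/-- The first factor of y may be taken to be a singular s. If the remaining factors are orthogonal
to s, it is absorbed into X; otherwise a single offending factor v₁ is isolated and treated by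
`mem_of_hyperbolic`. -/
theorem mul_mem_polarPower_of_perp [FiniteDimensional F V]
    (hk : (∃ t, D.σ t ≠ t) ∨ ((2 : F) ≠ 0 ∧ ∀ x y, D.h x y = D.h y x))
    {U M : Submodule F V} (hMU : M ≤ U)
    (hM : D.IsTS M) (hMn : ∀ x ∈ M, (∀ u ∈ U, D.h x u = 0) → x = 0) (i : ℕ) :
    ∀ (p : ℕ) (X : Submodule F V), D.IsTS X → X ≤ U →
      Module.finrank F X ≤ p → p + i ≤ Module.finrank F M →
      ∀ x ∈ wedgePower X p, ∀ y ∈ wedgePower (U ⊓ D.perp X) i,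
        x * y ∈ D.polarPower U (p + i) := by
  induction i with
  | zero =>
    intro p X hX hXU _ _ x hx y hy
    exact mul_mem_polarPower_of_mem_zero hX hXU hx hy
  | succ i ih =>
    intro p X hX hXU hp hpi x hx y hy
    have star : ∀ z ∈ U ⊓ D.perp X, D.sing z → ∀ q ∈ wedgePower (U ⊓ D.perp (X ⊔ F ∙ z)) i,
        x * (ExteriorAlgebra.ι F z * q) ∈ D.polarPower U (p + (i + 1)) := by
      intro z hz hzs q hq
      rw [← mul_assoc, show p + (i + 1) = p + 1 + i by omega]
      exact ih (p + 1) (X ⊔ F ∙ z) (hX.sup_span hzs hz.2) (sup_le hXU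
        ((Submodule.span_singleton_le_iff_mem z U).2 hz.1))
        ((finrank_sup_span_singleton_le _ _).trans (by omega)) (by omega) _
        (mul_ι_mem_wedgePower_sup z hx) q hq
    rw [← LinearMap.mulLeft_apply (R := F), ← Submodule.mem_comap]
    refine SetLike.le_def.1 ?_ hy
    refine wedgePower_succ_le fun v hv y' hy' => ?_
    change x * (ExteriorAlgebra.ι F v * y') ∈ D.polarPower U (p + (i + 1))
    refine mul_ι_mul_mem_of_sing (inf_perp_le_span_sing hMU hM hMn (by omega)) x y' ?_ hv
    intro s hs hss
    have hle : ∀ A : Submodule F V, A ≤ U ⊓ D.perp X → (∀ a ∈ A, D.h s a = 0) →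
        A ≤ U ⊓ D.perp (X ⊔ F ∙ s) := fun A hA hsA a ha =>
      ⟨(hA ha).1, mem_perp_sup.2 ⟨(hA ha).2, mem_perp_span_singleton.2 (hsA a ha)⟩⟩
    by_cases hperp : ∀ a ∈ U ⊓ D.perp X, D.h s a = 0
    · exact star s hs hss y' (wedgePower_mono (hle _ le_rfl hperp) _ hy')
    push Not at hperp
    obtain ⟨v₁, hv₁, hsv₁⟩ := hperp
    -- For i = 0 nothing follows s: y' is a scalar, and no orthogonality is required.
    rcases i with _ | j
    · refine star s hs hss y' ?_
      rwa [wedgePower_zero] at hy' ⊢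
    set A := U ⊓ D.perp (X ⊔ F ∙ s) with hA
    have hAle : U ⊓ D.perp X ≤ A ⊔ F ∙ v₁ := by
      intro a ha
      rw [← sub_add_cancel a ((D.h s a / D.h s v₁) • v₁)]
      refine Submodule.add_mem_sup ⟨Submodule.sub_mem _ ha.1 (Submodule.smul_mem _ _ hv₁.1),
        mem_perp_sup.2 ⟨Submodule.sub_mem _ ha.2 (Submodule.smul_mem _ _ hv₁.2),
        mem_perp_span_singleton.2 ?_⟩⟩
        (Submodule.smul_mem _ _ (Submodule.mem_span_singleton_self _))
      rw [map_sub, map_smul, smul_eq_mul, div_mul_cancel₀ _ hsv₁, sub_self]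
    obtain ⟨a, ha, b', ⟨b, hb, rfl⟩, rfl⟩ :=
      Submodule.mem_sup.1 (wedgePower_sup_span_le A v₁ (j + 1) (wedgePower_mono hAle _ hy'))
    rw [mul_add, mul_add]
    refine Submodule.add_mem _ (star s hs hss a ha) ?_
    clear ha hy' hy
    change b ∈ Submodule.comap (LinearMap.mulLeft F x ∘ₗ wedgeLeft s ∘ₗ wedgeLeft v₁)
      (D.polarPower U (p + (j + 1 + 1)))
    refine SetLike.le_def.1 ?_ hb
    -- Restricting to W of dimension at most j gives dim (X + ⟨s⟩ + W) ≤ p + 1 + j < dim M, leaving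
    -- room for a non-orthogonal pair orthogonal to all of it.
    refine wedgePower_le_of_finrank_le fun W hWA hW u hu => ?_
    have hfin : Module.finrank F ↥(X ⊔ F ∙ s ⊔ W) < Module.finrank F M := by
      have h1 := Submodule.finrank_add_le_finrank_add_finrank (X ⊔ F ∙ s) W
      have h2 := finrank_sup_span_singleton_le X s
      omega
    obtain ⟨e, he, f, hf, hef⟩ := exists_hyperbolic hMU hM hMn hfin
    have hperp3 : ∀ g ∈ D.perp (X ⊔ F ∙ s ⊔ W), g ∈ D.perp X ∧ D.h s g = 0 ∧ g ∈ D.perp W := by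
      intro g hg
      obtain ⟨h1, h2⟩ := mem_perp_sup.1 hg
      obtain ⟨h3, h4⟩ := mem_perp_sup.1 h1
      exact ⟨h3, mem_perp_span_singleton.1 h4, h2⟩
    obtain ⟨heX, hse, heW⟩ := hperp3 e he.2
    obtain ⟨hfX, hsf, hfW⟩ := hperp3 f hf.2
    let ω : V →ₗ[F] V →ₗ[F] ExteriorAlgebra F V := LinearMap.mk₂ F
      (fun z w => x * (ExteriorAlgebra.ι F z * (ExteriorAlgebra.ι F w * u)))
      (fun z z' w => by simp [add_mul, mul_add]) (fun c z w => by simp)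
      (fun z w w' => by simp [add_mul, mul_add]) (fun c z w => by simp)
    change ω s v₁ ∈ D.polarPower U (p + (j + 1 + 1))
    refine mem_of_hyperbolic hk (L := U ⊓ D.perp X ⊓ D.perp W) (L' := U ⊓ D.perp X) inf_le_left ω
      (fun v => ?_) (fun z hz w hw hzs hzw => ?_) (s := s) (v := v₁) (e := e) (f := f)
      ⟨hs, ?_⟩ hv₁ ⟨⟨hMU he.1, heX⟩, heW⟩ ⟨⟨hf.1, hfX⟩, hfW⟩ hss (hM e he.1).1 hse hsf hef hsv₁
    · change x * (ExteriorAlgebra.ι F v * (ExteriorAlgebra.ι F v * u)) = 0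
      rw [ι_mul_self, mul_zero]
    · refine star z hz.1 hzs _ (ι_mul_mem_wedgePower (U := U ⊓ D.perp (X ⊔ F ∙ z))
        ⟨hw.1, mem_perp_sup.2 ⟨hw.2, mem_perp_span_singleton.2 hzw⟩⟩
        (wedgePower_mono (U := W) ?_ _ hu))
      intro w' hw'
      have := hWA hw'
      refine ⟨this.1, mem_perp_sup.2 ⟨(mem_perp_sup.1 this.2).1,
        mem_perp_span_singleton.2 (D.refl _ _ (hz.2 w' hw'))⟩⟩
    · intro w hw
      exact D.refl _ _ (mem_perp_span_singleton.1 (mem_perp_sup.1 (hWA hw).2).2)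

/-- Below the Witt index, the totally singular subspaces of a Hermitian form, or of a quadratic form
in characteristic different from two, generate the full exterior power. -/
theorem polarPower_eq_wedgePower [FiniteDimensional F V]
    (hk : (∃ t, D.σ t ≠ t) ∨ ((2 : F) ≠ 0 ∧ ∀ x y, D.h x y = D.h y x))
    {U M : Submodule F V} (hMU : M ≤ U)
    (hM : D.IsTS M) (hMn : ∀ x ∈ M, (∀ u ∈ U, D.h x u = 0) → x = 0) {k : ℕ}
    (hkM : k ≤ Module.finrank F M) : D.polarPower U k = wedgePower U k := by
  refine le_antisymm (polarPower_le_wedgePower U k) fun x hx => ?_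
  have hU : U ≤ U ⊓ D.perp ⊥ := fun u hu =>
    ⟨hu, fun y hy => by rw [(Submodule.mem_bot F).1 hy, map_zero, LinearMap.zero_apply]⟩
  have := mul_mem_polarPower_of_perp hk hMU hM hMn k 0 ⊥ isTS_bot bot_le (by simp) (by omega) 1
    (by rw [wedgePower_zero]; exact Submodule.one_le.1 le_rfl) x (wedgePower_mono hU k hx)
  rwa [one_mul, Nat.zero_add] at this

end Full

end PolarData

/-! ### The exponential of contraction by an alternating form -/

section WedgeExp

variable {F V : Type*} [Field F] [AddCommGroup V] [Module F V]

/-- The sum of the powers of `U` of exponent at least `p`. -/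
noncomputable def wedgeFiltration (U : Submodule F V) (p : ℕ) : Submodule F (ExteriorAlgebra F V) :=
  ⨆ (i : ℕ) (_ : p ≤ i), wedgePower U i

theorem wedgePower_le_wedgeFiltration (U : Submodule F V) {p i : ℕ} (h : p ≤ i) :
    wedgePower U i ≤ wedgeFiltration U p := le_iSup₂_of_le i h le_rfl

theorem wedgeFiltration_le {U : Submodule F V} {p : ℕ} {S : Submodule F (ExteriorAlgebra F V)}
    (h : ∀ i, p ≤ i → wedgePower U i ≤ S) : wedgeFiltration U p ≤ S := iSup₂_le h

theorem wedgeFiltration_anti (U : Submodule F V) {p q : ℕ} (h : p ≤ q) :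
    wedgeFiltration U q ≤ wedgeFiltration U p :=
  wedgeFiltration_le fun _ hi => wedgePower_le_wedgeFiltration U (h.trans hi)

theorem wedgeFiltration_sup_span_le (U : Submodule F V) (r : V) (p : ℕ) :
    wedgeFiltration (U ⊔ F ∙ r) p
      ≤ wedgeFiltration U p ⊔ (wedgeFiltration U (p - 1)).map (wedgeLeft r) :=
  wedgeFiltration_le fun i hi => (wedgePower_sup_span_le U r i).trans
    (sup_le_sup (wedgePower_le_wedgeFiltration U hi)
      (Submodule.map_mono (wedgePower_le_wedgeFiltration U (Nat.sub_le_sub_right hi 1))))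

theorem wedgeContract_eq_zero {U : Submodule F V} {d : Module.Dual F V} (hd : ∀ u ∈ U, d u = 0)
    {p : ℕ} {x : ExteriorAlgebra F V} (hx : x ∈ wedgeFiltration U p) : wedgeContract d x = 0 :=
  LinearMap.mem_ker.1
    (SetLike.le_def.1 (wedgeFiltration_le fun i _ => wedgePower_le_ker_wedgeContract hd i) hx)

theorem ι_mul_mem_wedgeFiltration {U : Submodule F V} {u : V} (hu : u ∈ U)
    {x : ExteriorAlgebra F V} (hx : x ∈ wedgeFiltration U 0) :
    ExteriorAlgebra.ι F u * x ∈ wedgeFiltration U 0 := by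
  rw [← wedgeLeft_apply, ← Submodule.mem_comap]
  refine SetLike.le_def.1 (wedgeFiltration_le fun i _ y hy => ?_) hx
  exact wedgePower_le_wedgeFiltration U (Nat.zero_le (i + 1)) (ι_mul_mem_wedgePower hu hy)

theorem wedgeContract_mem_wedgeFiltration {U : Submodule F V} (d : Module.Dual F V)
    {x : ExteriorAlgebra F V} (hx : x ∈ wedgeFiltration U 0) :
    wedgeContract d x ∈ wedgeFiltration U 0 := by
  rw [← Submodule.mem_comap]
  refine SetLike.le_def.1 (wedgeFiltration_le fun i _ => ?_) hx
  clear hx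
  induction i with
  | zero =>
    rw [wedgePower_zero, Submodule.one_le, Submodule.mem_comap]
    have : wedgeContract d (1 : ExteriorAlgebra F V) = 0 :=
      CliffordAlgebra.contractLeft_one (Q := (0 : QuadraticForm F V)) (d := d)
    rw [this]
    exact Submodule.zero_mem _
  | succ i ih =>
    refine wedgePower_succ_le fun u hu x hx => ?_
    rw [Submodule.mem_comap, wedgeContract_ι_mul]
    exact Submodule.sub_mem _ (Submodule.smul_mem _ _
      (wedgePower_le_wedgeFiltration U (Nat.zero_le i) hx))
      (ι_mul_mem_wedgeFiltration hu (ih (Nat.zero_le i) hx))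

/-- The exponential of the contraction by an alternating form. -/
noncomputable def wedgeExp {b : LinearMap.BilinForm F V} (hb : b.IsAlt) :
    ExteriorAlgebra F V →ₗ[F] ExteriorAlgebra F V :=
  CliffordAlgebra.changeForm (Q := (0 : QuadraticForm F V)) (Q' := 0) (B := b)
    (by ext x; simpa using hb x)

variable {b : LinearMap.BilinForm F V} (hb : b.IsAlt)

theorem wedgeExp_one : wedgeExp hb 1 = 1 := CliffordAlgebra.changeForm_one _

theorem wedgeExp_ι_mul (v : V) (x : ExteriorAlgebra F V) :
    wedgeExp hb (ExteriorAlgebra.ι F v * x)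
      = ExteriorAlgebra.ι F v * wedgeExp hb x - wedgeContract (b v) (wedgeExp hb x) :=
  CliffordAlgebra.changeForm_ι_mul _ v x

/-- Contraction lowers degrees, so the bound p is lost; only membership in the subalgebra generated
by U survives. -/
theorem wedgeExp_mem {U : Submodule F V} {p : ℕ} {x : ExteriorAlgebra F V}
    (hx : x ∈ wedgeFiltration U p) : wedgeExp hb x ∈ wedgeFiltration U 0 := by
  rw [← Submodule.mem_comap]
  refine SetLike.le_def.1 (wedgeFiltration_le fun i _ => ?_)
    (wedgeFiltration_anti U (Nat.zero_le p) hx)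
  clear hx
  induction i with
  | zero =>
    rw [wedgePower_zero, Submodule.one_le, Submodule.mem_comap, wedgeExp_one]
    refine wedgePower_le_wedgeFiltration U le_rfl ?_
    rw [wedgePower_zero]
    exact Submodule.one_le.1 le_rfl
  | succ i ih =>
    refine wedgePower_succ_le fun u hu x hx => ?_
    rw [Submodule.mem_comap, wedgeExp_ι_mul]
    exact Submodule.sub_mem _ (ι_mul_mem_wedgeFiltration hu (ih (Nat.zero_le i) hx))
      (wedgeContract_mem_wedgeFiltration _ (ih (Nat.zero_le i) hx))

/-- Contractions by b(u, ·) with u in T kill every power of T. This is the source of the upper bound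
on the span. -/
theorem wedgeExp_eq_self {T : Submodule F V} (hT : ∀ x ∈ T, ∀ y ∈ T, b x y = 0) {k : ℕ}
    {x : ExteriorAlgebra F V} (hx : x ∈ wedgePower T k) : wedgeExp hb x = x := by
  have : wedgePower T k ≤ LinearMap.eqLocus (wedgeExp hb) LinearMap.id := by
    clear hx
    induction k with
    | zero =>
      rw [wedgePower_zero, Submodule.one_le]
      exact wedgeExp_one hb
    | succ k ih =>
      refine wedgePower_succ_le fun u hu x hx => ?_
      have h1 : wedgeExp hb x = x := ih hx
      have h2 : wedgeContract (b u) x = 0 :=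
        LinearMap.mem_ker.1 (wedgePower_le_ker_wedgeContract (hT u hu) k hx)
      change wedgeExp hb _ = _
      rw [wedgeExp_ι_mul, h1, h2, sub_zero]
      rfl
  exact this hx

/-- An orthogonal sum of `r` hyperbolic planes. -/
inductive IsHyperbolicSum (b : LinearMap.BilinForm F V) : ℕ → Submodule F V → Prop
  | bot : IsHyperbolicSum b 0 ⊥
  | sup {r : ℕ} {U : Submodule F V} {e f : V} (hU : IsHyperbolicSum b r U)
      (he : ∀ u ∈ U, b e u = 0) (hf : ∀ u ∈ U, b f u = 0) (hef : b e f = 1) :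
      IsHyperbolicSum b (r + 1) (U ⊔ F ∙ e ⊔ F ∙ f)

section Plane

variable {U : Submodule F V} {e f : V}

theorem wedgeExp_wedgeLeft {v : V} (hv : ∀ u ∈ U, b v u = 0) {x : ExteriorAlgebra F V} {p : ℕ}
    (hx : x ∈ wedgeFiltration U p) : wedgeExp hb (wedgeLeft v x) = wedgeLeft v (wedgeExp hb x) := by
  rw [wedgeLeft_apply, wedgeExp_ι_mul, wedgeContract_eq_zero hv (wedgeExp_mem hb hx), sub_zero]
  rfl

theorem apply_eq_zero_of_mem_sup_span {d : Module.Dual F V} (hd : ∀ u ∈ U, d u = 0)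
    (he : d e = 0) : ∀ u ∈ U ⊔ F ∙ e, d u = 0 := by
  intro u hu
  have : U ⊔ F ∙ e ≤ LinearMap.ker d :=
    sup_le hd ((Submodule.span_singleton_le_iff_mem _ _).2 he)
  exact this hu

/-- The plane ⟨e, f⟩ contributes only one contraction, of f∧e to -b(f,e) = 1, which adds x₃ to the
component x₀. -/
theorem wedgeExp_hyperbolic (he : ∀ u ∈ U, b e u = 0) (hf : ∀ u ∈ U, b f u = 0) (hef : b e f = 1)
    {x₀ x₁ x₂ x₃ : ExteriorAlgebra F V} (h₁ : x₁ ∈ wedgeFiltration U 0)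
    (h₂ : x₂ ∈ wedgeFiltration U 0) (h₃ : x₃ ∈ wedgeFiltration U 0) :
    wedgeExp hb (x₀ + wedgeLeft e x₁ + wedgeLeft f (x₂ + wedgeLeft e x₃))
      = wedgeExp hb (x₀ + x₃) + wedgeLeft e (wedgeExp hb x₁)
        + wedgeLeft f (wedgeExp hb x₂ + wedgeLeft e (wedgeExp hb x₃)) := by
  have hfe : b f e = -1 := by rw [← hb.neg_eq, hef]
  have h4 : wedgeExp hb (wedgeLeft f (wedgeLeft e x₃))
      = wedgeLeft f (wedgeLeft e (wedgeExp hb x₃)) + wedgeExp hb x₃ := by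
    rw [wedgeLeft_apply, wedgeExp_ι_mul, wedgeExp_wedgeLeft hb he h₃]
    nth_rewrite 2 [wedgeLeft_apply]
    rw [wedgeContract_ι_mul, hfe, wedgeContract_eq_zero hf (wedgeExp_mem hb h₃), mul_zero,
      neg_one_smul, sub_zero, sub_neg_eq_add]
    rfl
  simp only [map_add, wedgeExp_wedgeLeft hb he h₁, wedgeExp_wedgeLeft hb hf h₂, h4]
  abel

theorem hyperbolic_decomp_inj (hb : b.IsAlt) (he : ∀ u ∈ U, b e u = 0) (hf : ∀ u ∈ U, b f u = 0)
    (hef : b e f = 1) {x₀ x₁ x₂ x₃ y₀ y₁ y₂ y₃ : ExteriorAlgebra F V}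
    (h₀ : x₀ ∈ wedgeFiltration U 0) (h₁ : x₁ ∈ wedgeFiltration U 0)
    (h₂ : x₂ ∈ wedgeFiltration U 0) (h₃ : x₃ ∈ wedgeFiltration U 0)
    (k₀ : y₀ ∈ wedgeFiltration U 0) (k₁ : y₁ ∈ wedgeFiltration U 0)
    (k₂ : y₂ ∈ wedgeFiltration U 0) (k₃ : y₃ ∈ wedgeFiltration U 0)
    (h : x₀ + wedgeLeft e x₁ + wedgeLeft f (x₂ + wedgeLeft e x₃)
      = y₀ + wedgeLeft e y₁ + wedgeLeft f (y₂ + wedgeLeft e y₃)) :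
    (x₀ = y₀ ∧ x₁ = y₁) ∧ x₂ = y₂ ∧ x₃ = y₃ := by
  have hfe : (-b f) e = 1 := by rw [LinearMap.neg_apply, ← hb.neg_eq, hef, neg_neg]
  have hf' : ∀ u ∈ U, (-b f) u = 0 := fun u hu => by rw [LinearMap.neg_apply, hf u hu, neg_zero]
  have h5 : ∀ {x y}, x ∈ wedgeFiltration U 0 → y ∈ wedgeFiltration U 0 →
      wedgeContract (b e) (x + wedgeLeft e y) = 0 := by
    intro x y hx hy
    rw [map_add, wedgeLeft_apply, wedgeContract_ι_mul, wedgeContract_eq_zero he hx,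
      wedgeContract_eq_zero he hy, hb e, zero_smul, mul_zero, sub_zero, add_zero]
  obtain ⟨h6, h7⟩ := add_wedgeLeft_inj hef (h5 h₀ h₁) (h5 h₂ h₃) (h5 k₀ k₁) (h5 k₂ k₃) h
  have h8 : ∀ {x}, x ∈ wedgeFiltration U 0 → wedgeContract (-b f) x = 0 :=
    fun hx => wedgeContract_eq_zero hf' hx
  exact ⟨add_wedgeLeft_inj hfe (h8 h₀) (h8 h₁) (h8 k₀) (h8 k₁) h6,
    add_wedgeLeft_inj hfe (h8 h₂) (h8 h₃) (h8 k₂) (h8 k₃) h7⟩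

theorem exists_wedgeFiltration_decomp {p : ℕ} {x : ExteriorAlgebra F V}
    (hx : x ∈ wedgeFiltration (U ⊔ F ∙ e ⊔ F ∙ f) p) :
    ∃ x₀ ∈ wedgeFiltration U p, ∃ x₁ ∈ wedgeFiltration U (p - 1),
      ∃ x₂ ∈ wedgeFiltration U (p - 1), ∃ x₃ ∈ wedgeFiltration U (p - 1 - 1),
      x = x₀ + wedgeLeft e x₁ + wedgeLeft f (x₂ + wedgeLeft e x₃) := by
  obtain ⟨y, hy, _, ⟨z, hz, rfl⟩, rfl⟩ :=
    Submodule.mem_sup.1 (wedgeFiltration_sup_span_le _ _ _ hx)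
  obtain ⟨x₀, h₀, _, ⟨x₁, h₁, rfl⟩, rfl⟩ :=
    Submodule.mem_sup.1 (wedgeFiltration_sup_span_le _ _ _ hy)
  obtain ⟨x₂, h₂, _, ⟨x₃, h₃, rfl⟩, rfl⟩ :=
    Submodule.mem_sup.1 (wedgeFiltration_sup_span_le _ _ _ hz)
  exact ⟨x₀, h₀, x₁, h₁, x₂, h₂, x₃, h₃, rfl⟩

theorem exists_wedgePower_decomp {k : ℕ} {x : ExteriorAlgebra F V}
    (hx : x ∈ wedgePower (U ⊔ F ∙ e ⊔ F ∙ f) (k + 2)) :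
    ∃ x₀ ∈ wedgePower U (k + 2), ∃ x₁ ∈ wedgePower U (k + 1), ∃ x₂ ∈ wedgePower U (k + 1),
      ∃ x₃ ∈ wedgePower U k,
      x = x₀ + wedgeLeft e x₁ + wedgeLeft f (x₂ + wedgeLeft e x₃) := by
  obtain ⟨y, hy, _, ⟨z, hz, rfl⟩, rfl⟩ :=
    Submodule.mem_sup.1 (wedgePower_sup_span_le _ _ _ hx)
  obtain ⟨x₀, h₀, _, ⟨x₁, h₁, rfl⟩, rfl⟩ :=
    Submodule.mem_sup.1 (wedgePower_sup_span_le _ _ _ hy)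
  obtain ⟨x₂, h₂, _, ⟨x₃, h₃, rfl⟩, rfl⟩ :=
    Submodule.mem_sup.1 (wedgePower_sup_span_le _ _ _ hz)
  exact ⟨x₀, h₀, x₁, h₁, x₂, h₂, x₃, h₃, rfl⟩

end Plane

/-- On an orthogonal sum of `r` hyperbolic planes, the filtration by the degree and its image under
the exponential of the contraction are opposite. -/
theorem IsHyperbolicSum.eq_zero_of_mem {r : ℕ} {U : Submodule F V} (hU : IsHyperbolicSum b r U) :
    ∀ {p q : ℕ} {x : ExteriorAlgebra F V}, 2 * r + 1 ≤ p + q → x ∈ wedgeFiltration U p →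
      wedgeExp hb x ∈ wedgeFiltration U q → x = 0 := by
  induction hU with
  | bot =>
    intro p q x hpq hx hφ
    have hpos : ∀ {p : ℕ} {y : ExteriorAlgebra F V}, 1 ≤ p →
        y ∈ wedgeFiltration (⊥ : Submodule F V) p → y = 0 := by
      intro p y hp hy
      have : wedgeFiltration (⊥ : Submodule F V) p ≤ ⊥ := wedgeFiltration_le fun i hi => by
        obtain ⟨j, rfl⟩ := Nat.exists_eq_add_of_le' (hp.trans hi)
        rw [wedgePower_bot_succ]
      exact (Submodule.mem_bot F).1 (this hy)
    rcases Nat.eq_zero_or_pos p with rfl | hp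
    · have h1 : wedgeExp hb x = x := by
        have : wedgeFiltration (⊥ : Submodule F V) 0
            ≤ LinearMap.eqLocus (wedgeExp hb) LinearMap.id :=
          wedgeFiltration_le fun i _ y hy => wedgeExp_eq_self hb (fun x hx y _ => by
            rw [(Submodule.mem_bot F).1 hx, map_zero, LinearMap.zero_apply]) hy
        exact this hx
      rw [← h1]
      exact hpos (by omega) hφ
    · exact hpos hp hx
  | @sup r U e f hU he hf hef ih =>
    intro p q x hpq hx hφ
    obtain ⟨x₀, h₀, x₁, h₁, x₂, h₂, x₃, h₃, rfl⟩ := exists_wedgeFiltration_decomp hx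
    obtain ⟨y₀, k₀, y₁, k₁, y₂, k₂, y₃, k₃, e1⟩ := exists_wedgeFiltration_decomp hφ
    have z : ∀ {p y}, y ∈ wedgeFiltration U p → y ∈ wedgeFiltration U 0 :=
      fun hy => wedgeFiltration_anti U (Nat.zero_le _) hy
    rw [wedgeExp_hyperbolic hb he hf hef (z h₁) (z h₂) (z h₃)] at e1
    have h03 : x₀ + x₃ ∈ wedgeFiltration U (p - 1 - 1) :=
      Submodule.add_mem _ (wedgeFiltration_anti U (by omega) h₀) h₃
    obtain ⟨⟨e0, e1⟩, e2, e3⟩ := hyperbolic_decomp_inj hb he hf hef (wedgeExp_mem hb h03)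
      (wedgeExp_mem hb h₁) (wedgeExp_mem hb h₂) (wedgeExp_mem hb h₃) (z k₀) (z k₁) (z k₂) (z k₃) e1
    have z₁ : x₁ = 0 := ih (by omega) h₁ (e1 ▸ k₁)
    have z₂ : x₂ = 0 := ih (by omega) h₂ (e2 ▸ k₂)
    have z₀₃ : x₀ + x₃ = 0 := ih (by omega) h03 (e0 ▸ k₀)
    -- Induction kills only the sum x₀ + x₃. But x₀ has filtration p, and the f∧e component places
    -- the exponential of x₃ = -x₀ in filtration q - 2, so induction applies once more.
    have e4 : x₃ = -x₀ := eq_neg_of_add_eq_zero_right z₀₃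
    have z₀ : x₀ = 0 := by
      refine ih (q := q - 1 - 1) (by omega) h₀ ?_
      rw [e4, map_neg, neg_eq_iff_eq_neg] at e3
      rw [e3]
      exact Submodule.neg_mem _ k₃
    rw [e4, z₀, z₁, z₂]
    simp

end WedgeExp

/-! ### The dimension for alternating forms -/

/-- The binomial coefficient `m.choose (k - 2)`, taken to be zero for `k < 2`. -/
def chooseSubTwo (m : ℕ) : ℕ → ℕ
  | 0 => 0
  | 1 => 0
  | k + 2 => m.choose k

theorem chooseSubTwo_recurrence (m k : ℕ) :
    chooseSubTwo (m + 2) (k + 2)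
      = chooseSubTwo m (k + 2) + (chooseSubTwo m (k + 1) + chooseSubTwo m (k + 1))
        + chooseSubTwo m k := by
  rcases k with _ | _ | k
  · simp [chooseSubTwo]
  · simp [chooseSubTwo]
  · simp only [chooseSubTwo, Nat.choose_succ_succ, Nat.succ_eq_add_one]
    ring

theorem choose_add_two (m k : ℕ) : (m + 2).choose (k + 2)
    = m.choose (k + 2) + (m.choose (k + 1) + m.choose (k + 1)) + m.choose k := by
  simp only [Nat.choose_succ_succ, Nat.succ_eq_add_one]
  ring

section Alternating

variable {F V : Type*} [Field F] [AddCommGroup V] [Module F V]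

theorem finrank_sup_span_of_notMem [FiniteDimensional F V] {U : Submodule F V} {r : V}
    (hr : r ∉ U) : Module.finrank F ↥(U ⊔ F ∙ r) = Module.finrank F U + 1 := by
  have h := Submodule.finrank_sup_add_finrank_inf_eq U (F ∙ r)
  have h0 : r ≠ 0 := fun h => hr (h ▸ Submodule.zero_mem U)
  have hinf : U ⊓ F ∙ r = ⊥ := (Submodule.disjoint_span_singleton' h0).2 hr |>.eq_bot
  rw [hinf, finrank_bot, finrank_span_singleton h0] at h
  exact h

/-- The polar data of an alternating form, for which all vectors are singular. -/
noncomputable def PolarData.ofAlt {b : LinearMap.BilinForm F V} (hb : b.IsAlt) :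
    PolarData F V where
  σ := RingHom.id F
  invol _ := rfl
  h := b
  refl x y h := hb.isRefl x y h
  sing _ := True
  sing_zero := trivial
  sing_self x _ := hb x
  sing_add _ _ _ _ _ := trivial
  sing_smul _ _ _ := trivial
  exists_sing _ _ _ _ := ⟨0, trivial⟩

variable {b : LinearMap.BilinForm F V} (hb : b.IsAlt)

theorem isTS_ofAlt {T : Submodule F V} :
    (PolarData.ofAlt hb).IsTS T ↔ ∀ x ∈ T, ∀ y ∈ T, b x y = 0 :=
  ⟨fun h x hx => (h x hx).2, fun h x hx => ⟨trivial, h x hx⟩⟩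

/-- The elements of the `k`-th power of `U` fixed by the exponential of the contraction. -/
noncomputable def wedgeFixed (U : Submodule F V) (k : ℕ) : Submodule F (ExteriorAlgebra F V) :=
  wedgePower U k ⊓ LinearMap.eqLocus (wedgeExp hb) LinearMap.id

instance [FiniteDimensional F V] (U : Submodule F V) (k : ℕ) :
    FiniteDimensional F (wedgeFixed hb U k) :=
  Submodule.finiteDimensional_of_le (inf_le_left : _ ≤ wedgePower U k)

theorem mem_wedgeFixed {U : Submodule F V} {k : ℕ} {x : ExteriorAlgebra F V} :
    x ∈ wedgeFixed hb U k ↔ x ∈ wedgePower U k ∧ wedgeExp hb x = x := Iff.rfl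

theorem polarPower_le_wedgeFixed (U : Submodule F V) (k : ℕ) :
    (PolarData.ofAlt hb).polarPower U k ≤ wedgeFixed hb U k :=
  PolarData.polarPower_le fun _ hT hs _ hx => (mem_wedgeFixed hb).2
    ⟨wedgePower_mono hT k hx, wedgeExp_eq_self hb ((isTS_ofAlt hb).1 hs) hx⟩

section Plane

variable {U : Submodule F V} {e f : V}

theorem contract_contract_hyperbolic (hb : b.IsAlt) (he : ∀ u ∈ U, b e u = 0)
    (hf : ∀ u ∈ U, b f u = 0)
    (hef : b e f = 1) {x₀ x₁ x₂ x₃ : ExteriorAlgebra F V} (h₀ : x₀ ∈ wedgeFiltration U 0)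
    (h₁ : x₁ ∈ wedgeFiltration U 0)
    (h₂ : x₂ ∈ wedgeFiltration U 0) (h₃ : x₃ ∈ wedgeFiltration U 0) :
    (wedgeContract (-b f) ∘ₗ wedgeContract (b e))
      (x₀ + wedgeLeft e x₁ + wedgeLeft f (x₂ + wedgeLeft e x₃)) = x₃ := by
  have hfe : (-b f) e = 1 := by rw [LinearMap.neg_apply, ← hb.neg_eq, hef, neg_neg]
  have hf' : ∀ u ∈ U, (-b f) u = 0 := fun u hu => by rw [LinearMap.neg_apply, hf u hu, neg_zero]
  have h5 : ∀ {x y}, x ∈ wedgeFiltration U 0 → y ∈ wedgeFiltration U 0 →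
      wedgeContract (b e) (x + wedgeLeft e y) = 0 := by
    intro x y hx hy
    rw [map_add, wedgeLeft_apply, wedgeContract_ι_mul, wedgeContract_eq_zero he hx,
      wedgeContract_eq_zero he hy, hb e, zero_smul, mul_zero, sub_zero, add_zero]
  rw [LinearMap.comp_apply, wedgeContract_add_wedgeLeft hef (h5 h₀ h₁) (h5 h₂ h₃),
    wedgeContract_add_wedgeLeft hfe (wedgeContract_eq_zero hf' h₂) (wedgeContract_eq_zero hf' h₃)]

/-- Rank-nullity for the double contraction x ↦ x₃. For a fixed x the components x₁, x₂, x₃ are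
fixed, and x₀ is fixed as well when x₃ = 0. -/
theorem finrank_wedgeFixed_sup_le [FiniteDimensional F V] (he : ∀ u ∈ U, b e u = 0)
    (hf : ∀ u ∈ U, b f u = 0) (hef : b e f = 1) (k : ℕ) :
    Module.finrank F (wedgeFixed hb (U ⊔ F ∙ e ⊔ F ∙ f) (k + 2))
      ≤ Module.finrank F (wedgeFixed hb U (k + 2)) + (Module.finrank F (wedgeFixed hb U (k + 1))
        + Module.finrank F (wedgeFixed hb U (k + 1))) + Module.finrank F (wedgeFixed hb U k) := by
  have z : ∀ {k y}, y ∈ wedgePower U k → y ∈ wedgeFiltration U 0 :=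
    fun hy => wedgePower_le_wedgeFiltration U (Nat.zero_le _) hy
  have decomp : ∀ x ∈ wedgeFixed hb (U ⊔ F ∙ e ⊔ F ∙ f) (k + 2), ∃ x₀ ∈ wedgePower U (k + 2),
      ∃ x₁ ∈ wedgeFixed hb U (k + 1), ∃ x₂ ∈ wedgeFixed hb U (k + 1), ∃ x₃ ∈ wedgeFixed hb U k,
      x = x₀ + wedgeLeft e x₁ + wedgeLeft f (x₂ + wedgeLeft e x₃) ∧
      wedgeExp hb (x₀ + x₃) = x₀ := by
    rintro x ⟨hx, hφ⟩
    obtain ⟨x₀, h₀, x₁, h₁, x₂, h₂, x₃, h₃, rfl⟩ := exists_wedgePower_decomp hx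
    change wedgeExp hb _ = _ at hφ
    rw [wedgeExp_hyperbolic hb he hf hef (z h₁) (z h₂) (z h₃)] at hφ
    obtain ⟨⟨e0, e1⟩, e2, e3⟩ := hyperbolic_decomp_inj hb he hf hef
      (wedgeExp_mem hb (Submodule.add_mem _ (z h₀) (z h₃))) (wedgeExp_mem hb (z h₁))
      (wedgeExp_mem hb (z h₂)) (wedgeExp_mem hb (z h₃)) (z h₀) (z h₁) (z h₂) (z h₃) hφ
    exact ⟨x₀, h₀, x₁, ⟨h₁, e1⟩, x₂, ⟨h₂, e2⟩, x₃, ⟨h₃, e3⟩, rfl, e0⟩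
  set K := wedgeFixed hb (U ⊔ F ∙ e ⊔ F ∙ f) (k + 2) with hK
  set g := wedgeContract (-b f) ∘ₗ wedgeContract (b e) with hg
  have h1 : K.map g ≤ wedgeFixed hb U k := by
    rintro _ ⟨x, hx, rfl⟩
    obtain ⟨x₀, h₀, x₁, h₁, x₂, h₂, x₃, h₃, rfl, _⟩ := decomp x hx
    rw [hg, contract_contract_hyperbolic hb he hf hef (z h₀) (z h₁.1) (z h₂.1) (z h₃.1)]
    exact h₃
  have h2 : K ⊓ LinearMap.ker g ≤ (wedgeFixed hb U (k + 2)
      ⊔ (wedgeFixed hb U (k + 1)).map (wedgeLeft e))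
      ⊔ (wedgeFixed hb U (k + 1)).map (wedgeLeft f) := by
    rintro x ⟨hx, hgx⟩
    obtain ⟨x₀, h₀, x₁, h₁, x₂, h₂, x₃, h₃, rfl, e0⟩ := decomp x hx
    have : x₃ = 0 := by
      rw [← contract_contract_hyperbolic hb he hf hef (z h₀) (z h₁.1) (z h₂.1) (z h₃.1)]
      exact hgx
    subst this
    rw [add_zero] at e0
    rw [map_zero, add_zero]
    exact Submodule.add_mem_sup (Submodule.add_mem_sup ⟨h₀, e0⟩ ⟨x₁, h₁, rfl⟩) ⟨x₂, h₂, rfl⟩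
  have h3 := finrank_map_add_finrank_inf_ker g K
  have h4 := Submodule.finrank_mono h1
  have h5 := Submodule.finrank_mono h2
  have h6 := Submodule.finrank_add_le_finrank_add_finrank (wedgeFixed hb U (k + 2)
      ⊔ (wedgeFixed hb U (k + 1)).map (wedgeLeft e)) ((wedgeFixed hb U (k + 1)).map (wedgeLeft f))
  have h7 := Submodule.finrank_add_le_finrank_add_finrank (wedgeFixed hb U (k + 2))
    ((wedgeFixed hb U (k + 1)).map (wedgeLeft e))
  have h8 := Submodule.finrank_map_le (wedgeLeft e) (wedgeFixed hb U (k + 1))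
  have h9 := Submodule.finrank_map_le (wedgeLeft f) (wedgeFixed hb U (k + 1))
  omega

/-- Rank-nullity for the same double contraction: its kernel contains the powers using at most one
of e, f, and `hpair` makes its image contain all of `polarPower U k`. -/
theorem le_finrank_polarPower_sup [FiniteDimensional F V] (he : ∀ u ∈ U, b e u = 0)
    (hf : ∀ u ∈ U, b f u = 0) (hef : b e f = 1) {k : ℕ}
    (hpair : ∀ T ≤ U, Module.finrank F T ≤ k → ∃ v ∈ U ⊓ (PolarData.ofAlt hb).perp T,
      ∃ w ∈ U ⊓ (PolarData.ofAlt hb).perp T, b v w ≠ 0) :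
    Module.finrank F ((PolarData.ofAlt hb).polarPower U (k + 2))
        + (Module.finrank F ((PolarData.ofAlt hb).polarPower U (k + 1))
          + Module.finrank F ((PolarData.ofAlt hb).polarPower U (k + 1)))
        + Module.finrank F ((PolarData.ofAlt hb).polarPower U k)
      ≤ Module.finrank F ((PolarData.ofAlt hb).polarPower (U ⊔ F ∙ e ⊔ F ∙ f) (k + 2)) := by
  set D := PolarData.ofAlt hb with hD
  have hfe : b f e = -1 := by rw [← hb.neg_eq, hef]
  have hfe' : (-b f) e = 1 := by rw [LinearMap.neg_apply, hfe, neg_neg]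
  have hf' : ∀ u ∈ U, (-b f) u = 0 := fun u hu => by rw [LinearMap.neg_apply, hf u hu, neg_zero]
  have z : ∀ {k y}, y ∈ D.polarPower U k → y ∈ wedgeFiltration U 0 :=
    fun hy => wedgePower_le_wedgeFiltration U (Nat.zero_le _)
      (PolarData.polarPower_le_wedgePower _ _ hy)
  have zz : (0 : ExteriorAlgebra F V) ∈ wedgeFiltration U 0 := Submodule.zero_mem _
  set I := D.polarPower (U ⊔ F ∙ e ⊔ F ∙ f) (k + 2) with hI
  set g := wedgeContract (-b f) ∘ₗ wedgeContract (b e) with hg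
  have hUle : U ≤ U ⊔ F ∙ e ⊔ F ∙ f := le_sup_left.trans le_sup_left
  have heU : e ∈ U ⊔ F ∙ e ⊔ F ∙ f := Submodule.mem_sup_left
    (Submodule.mem_sup_right (Submodule.mem_span_singleton_self e))
  have hfU : f ∈ U ⊔ F ∙ e ⊔ F ∙ f :=
    Submodule.mem_sup_right (Submodule.mem_span_singleton_self f)
  have hleft : ∀ v ∈ U ⊔ F ∙ e ⊔ F ∙ f, (∀ u ∈ U, b v u = 0) →
      (D.polarPower U (k + 1)).map (wedgeLeft v) ≤ I := by
    intro v hv hvU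
    rw [Submodule.map_le_iff_le_comap]
    refine PolarData.polarPower_le fun T hT hs x hx => ?_
    refine PolarData.wedgePower_le_polarPower (T := T ⊔ F ∙ v)
      (sup_le (hT.trans hUle) ((Submodule.span_singleton_le_iff_mem _ _).2 hv))
      (hs.sup_span trivial fun y hy => hb.isRefl _ _ (hvU y (hT hy))) _
      (wedgeLeft_mem_wedgePower_sup hx)
  have h1 : (D.polarPower U (k + 2) ⊔ (D.polarPower U (k + 1)).map (wedgeLeft e))
      ⊔ (D.polarPower U (k + 1)).map (wedgeLeft f) ≤ I ⊓ LinearMap.ker g := by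
    refine le_inf (sup_le (sup_le (PolarData.polarPower_mono hUle _) (hleft e heU he))
      (hleft f hfU hf)) ?_
    intro x hx
    obtain ⟨y, hy, _, ⟨x₂, h₂, rfl⟩, rfl⟩ := Submodule.mem_sup.1 hx
    obtain ⟨x₀, h₀, _, ⟨x₁, h₁, rfl⟩, rfl⟩ := Submodule.mem_sup.1 hy
    have := contract_contract_hyperbolic hb he hf hef (z h₀) (z h₁) (z h₂) zz
    rw [map_zero, add_zero] at this
    exact LinearMap.mem_ker.2 this
  have h2 : D.polarPower U k ≤ I.map g := by
    refine PolarData.polarPower_le fun T hT hs => wedgePower_le_of_finrank_le fun T' hT' hfin => ?_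
    intro x hx
    obtain ⟨v, hv, w, hw, hvw⟩ := hpair T' (hT'.trans hT) hfin
    -- The scaling b(v,w') = -1 cancels b(e,f) = 1, so e + v and f + w' are orthogonal; in (f +
    -- w')∧(e + v)∧x the coefficient of f∧e is x.
    set w' := (-(b v w)⁻¹) • w with hw'
    have hvw' : b v w' = -1 := by
      rw [hw', map_smul, smul_eq_mul, neg_mul, inv_mul_cancel₀ hvw]
    have hw'U : w' ∈ U ⊓ D.perp T' := Submodule.smul_mem _ _ hw
    have hTS : D.IsTS (T' ⊔ F ∙ (e + v) ⊔ F ∙ (f + w')) := by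
      refine ((hs.mono hT').sup_span trivial fun y hy => ?_).sup_span trivial
        (PolarData.mem_perp_sup.2 ⟨fun y hy => ?_, PolarData.mem_perp_span_singleton.2 ?_⟩)
      · rw [map_add, hv.2 y hy, add_zero]
        exact hb.isRefl _ _ (he y (hT (hT' hy)))
      · rw [map_add, hw'U.2 y hy, add_zero]
        exact hb.isRefl _ _ (hf y (hT (hT' hy)))
      · change b (e + v) (f + w') = 0
        rw [map_add, map_add, LinearMap.add_apply, LinearMap.add_apply, hef, he _ hw'U.1,
          hb.isRefl _ _ (hf v hv.1), hvw']
        simp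
    have hle : T' ⊔ F ∙ (e + v) ⊔ F ∙ (f + w') ≤ U ⊔ F ∙ e ⊔ F ∙ f := by
      refine sup_le (sup_le ((hT'.trans hT).trans hUle) ?_) ?_
      · exact (Submodule.span_singleton_le_iff_mem _ _).2 (Submodule.add_mem _ heU (hUle hv.1))
      · exact (Submodule.span_singleton_le_iff_mem _ _).2 (Submodule.add_mem _ hfU (hUle hw'U.1))
    refine ⟨wedgeLeft (f + w') (wedgeLeft (e + v) x),
      PolarData.wedgePower_le_polarPower hle hTS _
        (wedgeLeft_mem_wedgePower_sup (wedgeLeft_mem_wedgePower_sup hx)), ?_⟩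
    have hxU : x ∈ wedgeFiltration U 0 :=
      wedgePower_le_wedgeFiltration U (Nat.zero_le k) (wedgePower_mono (hT'.trans hT) k hx)
    have e1 : wedgeLeft (f + w') (wedgeLeft (e + v) x)
        = wedgeLeft w' (wedgeLeft v x) + wedgeLeft e (-wedgeLeft w' x)
          + wedgeLeft f (wedgeLeft v x + wedgeLeft e x) := by
      simp only [wedgeLeft_apply, map_add, add_mul, mul_neg, ι_mul_swap w' e]
      abel
    rw [e1]
    exact contract_contract_hyperbolic hb he hf hef
      (ι_mul_mem_wedgeFiltration hw'U.1 (ι_mul_mem_wedgeFiltration hv.1 hxU))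
      (Submodule.neg_mem _ (ι_mul_mem_wedgeFiltration hw'U.1 hxU))
      (ι_mul_mem_wedgeFiltration hv.1 hxU) hxU
  have h3 := finrank_map_add_finrank_inf_ker g I
  have h4 := Submodule.finrank_mono h1
  have h5 := Submodule.finrank_mono h2
  have hU' : ∀ j, D.polarPower U j ≤ LinearMap.ker (wedgeContract (b e)) := fun j =>
    (PolarData.polarPower_le_wedgePower U j).trans (wedgePower_le_ker_wedgeContract he j)
  have hU'' : ∀ j, D.polarPower U j ≤ LinearMap.ker (wedgeContract (-b f)) := fun j =>
    (PolarData.polarPower_le_wedgePower U j).trans (wedgePower_le_ker_wedgeContract hf' j)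
  have h6 := finrank_sup_map_wedgeLeft hfe' (D.polarPower U (k + 2)) (D.polarPower U (k + 1))
    (hU'' _) (hU'' _)
  have h7 := finrank_sup_map_wedgeLeft hef
    (D.polarPower U (k + 2) ⊔ (D.polarPower U (k + 1)).map (wedgeLeft e)) (D.polarPower U (k + 1))
    (sup_le (hU' _) (by
      rintro _ ⟨x, hx, rfl⟩
      rw [LinearMap.mem_ker, wedgeLeft_apply, wedgeContract_ι_mul, hb e, zero_smul,
        LinearMap.mem_ker.1 (hU' _ hx), mul_zero, sub_zero])) (hU' _)
  omega

end Plane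

namespace IsHyperbolicSum

theorem nondegenerate (hb : b.IsAlt) {r : ℕ} {U : Submodule F V} (hU : IsHyperbolicSum b r U) :
    ∀ x ∈ U, (∀ u ∈ U, b x u = 0) → x = 0 := by
  induction hU with
  | bot => exact fun x hx _ => (Submodule.mem_bot F).1 hx
  | @sup r U e f hU he hf hef ih =>
    intro x hx h
    obtain ⟨y, hy, z, hz, rfl⟩ := Submodule.mem_sup.1 hx
    obtain ⟨u, hu, w, hw, rfl⟩ := Submodule.mem_sup.1 hy
    obtain ⟨α, rfl⟩ := Submodule.mem_span_singleton.1 hw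
    obtain ⟨β, rfl⟩ := Submodule.mem_span_singleton.1 hz
    have hfe : b f e = -1 := by rw [← hb.neg_eq, hef]
    have h1 := h f (Submodule.mem_sup_right (Submodule.mem_span_singleton_self f))
    have h2 := h e (Submodule.mem_sup_left
      (Submodule.mem_sup_right (Submodule.mem_span_singleton_self e)))
    simp only [map_add, map_smul, LinearMap.add_apply, LinearMap.smul_apply, hef, hb f, hb e,
      hb.isRefl _ _ (hf u hu), hb.isRefl _ _ (he u hu), hfe, smul_eq_mul, mul_one, mul_zero,
      zero_add, add_zero, mul_neg, neg_eq_zero] at h1 h2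
    subst h1 h2
    simp only [zero_smul, add_zero] at h ⊢
    exact ih u hu fun u' hu' => h u' (Submodule.mem_sup_left (Submodule.mem_sup_left hu'))

theorem notMem (hb : b.IsAlt) {U : Submodule F V} {e f : V} (he : ∀ u ∈ U, b e u = 0)
    (hf : ∀ u ∈ U, b f u = 0) (hef : b e f = 1) : e ∉ U ∧ f ∉ U ⊔ F ∙ e := by
  refine ⟨fun h => ?_, fun h => ?_⟩
  · have := hf e h
    rw [← hb.neg_eq, hef] at this
    simp at this
  · have := apply_eq_zero_of_mem_sup_span he (hb e) f h
    rw [hef] at this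
    exact one_ne_zero this

theorem finrank_eq [FiniteDimensional F V] (hb : b.IsAlt) {r : ℕ} {U : Submodule F V}
    (hU : IsHyperbolicSum b r U) : Module.finrank F U = 2 * r := by
  induction hU with
  | bot => simp
  | @sup r U e f hU he hf hef ih =>
    obtain ⟨h1, h2⟩ := notMem hb he hf hef
    rw [finrank_sup_span_of_notMem h2, finrank_sup_span_of_notMem h1, ih]
    ring

theorem exists_lagrangian [FiniteDimensional F V] (hb : b.IsAlt) {r : ℕ} {U : Submodule F V}
    (hU : IsHyperbolicSum b r U) : ∃ Y ≤ U, (∀ x ∈ Y, ∀ y ∈ Y, b x y = 0) ∧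
      Module.finrank F Y = r ∧ ∀ v ∈ U, (∀ y ∈ Y, b y v = 0) → v ∈ Y := by
  induction hU with
  | bot => exact ⟨⊥, le_rfl, fun x hx y _ => by
      rw [(Submodule.mem_bot F).1 hx, map_zero, LinearMap.zero_apply], by simp, fun v hv _ => hv⟩
  | @sup r U e f hU he hf hef ih =>
    obtain ⟨Y, hYU, hY, hr, hmax⟩ := ih
    obtain ⟨h1, -⟩ := notMem hb he hf hef
    refine ⟨Y ⊔ F ∙ e, (sup_le_sup_right hYU _).trans le_sup_left, ?_, ?_, ?_⟩
    · exact (isTS_ofAlt hb).1 (((isTS_ofAlt hb).2 hY).sup_span trivial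
        fun y hy => hb.isRefl _ _ (he y (hYU hy)))
    · rw [finrank_sup_span_of_notMem fun h => h1 (hYU h), hr]
    · intro v hv h
      obtain ⟨y, hy, z, hz, rfl⟩ := Submodule.mem_sup.1 hv
      obtain ⟨u, hu, w, hw, rfl⟩ := Submodule.mem_sup.1 hy
      obtain ⟨α, rfl⟩ := Submodule.mem_span_singleton.1 hw
      obtain ⟨β, rfl⟩ := Submodule.mem_span_singleton.1 hz
      have h2 := h e (Submodule.mem_sup_right (Submodule.mem_span_singleton_self e))
      simp only [map_add, map_smul, he u hu, hb e, hef, smul_eq_mul, mul_one, mul_zero,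
        zero_add, add_zero] at h2
      subst h2
      rw [zero_smul, add_zero] at h ⊢
      refine Submodule.add_mem_sup (hmax u hu fun y hy => ?_) hw
      have h3 := h y (Submodule.mem_sup_left hy)
      rwa [map_add, map_smul, hb.isRefl _ _ (he y (hYU hy)), smul_zero, add_zero] at h3

/-- The range includes r + 1, one above the Witt index, because degree r + 1 on r + 1 planes calls
for degree r + 1 on r planes. -/
theorem finrank_wedgeFixed_add_le [FiniteDimensional F V] (hb : b.IsAlt) {r : ℕ}
    {U : Submodule F V} (hU : IsHyperbolicSum b r U) : ∀ k ≤ r + 1,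
      Module.finrank F (wedgeFixed hb U k) + chooseSubTwo (2 * r) k ≤ (2 * r).choose k := by
  have small : ∀ {r : ℕ} {U : Submodule F V}, IsHyperbolicSum b r U → ∀ k < 2,
      Module.finrank F (wedgeFixed hb U k) + chooseSubTwo (2 * r) k ≤ (2 * r).choose k := by
    intro r U hU k hk
    have h0 : chooseSubTwo (2 * r) k = 0 := by
      interval_cases k <;> rfl
    rw [h0, add_zero, ← hU.finrank_eq hb, ← finrank_wedgePower]
    exact Submodule.finrank_mono inf_le_left
  induction hU with
  | bot => exact fun k hk => small .bot k (by omega)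
  | @sup r U e f hU he hf hef ih =>
    intro k hk
    rcases k with _ | _ | k
    · exact small (.sup hU he hf hef) 0 (by omega)
    · exact small (.sup hU he hf hef) 1 (by omega)
    rcases Nat.lt_or_ge k r with hlt | hge
    · have h1 := ih (k + 2) (by omega)
      have h2 := ih (k + 1) (by omega)
      have h3 := ih k (by omega)
      have h4 := finrank_wedgeFixed_sup_le hb he hf hef k
      rw [show k + 1 + 1 = k + 2 from rfl, mul_add, mul_one, chooseSubTwo_recurrence,
        choose_add_two]
      omega
    -- In the top degree r + 2 the recurrence is unavailable. A fixed x and its exponential both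
    -- have filtration r + 2 on r + 1 planes, so x = 0, and the two binomials agree by symmetry.
    · obtain rfl : k = r := by omega
      have h0 : wedgeFixed hb (U ⊔ F ∙ e ⊔ F ∙ f) (k + 2) = ⊥ := by
        refine (Submodule.eq_bot_iff _).2 fun x hx => ?_
        have hx' := wedgePower_le_wedgeFiltration _ le_rfl hx.1
        refine (IsHyperbolicSum.sup hU he hf hef).eq_zero_of_mem hb (p := k + 2) (q := k + 2)
          (by omega) hx' ?_
        rw [((mem_wedgeFixed hb).1 hx).2]
        exact hx'
      rw [h0, finrank_bot, zero_add]
      exact (Nat.choose_symm_of_eq_add (by omega)).le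

/-- The pairs required by the recurrence come from `exists_hyperbolic` applied to a Lagrangian of
dimension r > k. In the top degree the correction term alone equals the binomial. -/
theorem le_finrank_polarPower_add [FiniteDimensional F V] (hb : b.IsAlt) {r : ℕ}
    {U : Submodule F V} (hU : IsHyperbolicSum b r U) : ∀ k ≤ r + 1, (2 * r).choose k
      ≤ Module.finrank F ((PolarData.ofAlt hb).polarPower U k) + chooseSubTwo (2 * r) k := by
  have small : ∀ {r : ℕ} {U : Submodule F V}, IsHyperbolicSum b r U → ∀ k < 2, (2 * r).choose k
      ≤ Module.finrank F ((PolarData.ofAlt hb).polarPower U k) + chooseSubTwo (2 * r) k := by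
    intro r U hU k hk
    rw [← hU.finrank_eq hb, ← finrank_wedgePower]
    refine le_trans (Submodule.finrank_mono ?_) (Nat.le_add_right _ _)
    refine wedgePower_le_of_finrank_le fun T hT hfin => ?_
    refine PolarData.wedgePower_le_polarPower hT ((isTS_ofAlt hb).2 fun x hx y hy => ?_) k
    obtain ⟨v, hv⟩ := finrank_le_one_iff.1 (hfin.trans (by omega : k ≤ 1))
    obtain ⟨c, hc⟩ := hv ⟨x, hx⟩
    obtain ⟨c', hc'⟩ := hv ⟨y, hy⟩
    have hx : c • (v : V) = x := congrArg Subtype.val hc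
    have hy : c' • (v : V) = y := congrArg Subtype.val hc'
    rw [← hx, ← hy]
    simp [hb (v : V)]
  induction hU with
  | bot => exact fun k hk => small .bot k (by omega)
  | @sup r U e f hU he hf hef ih =>
    intro k hk
    rcases k with _ | _ | k
    · exact small (.sup hU he hf hef) 0 (by omega)
    · exact small (.sup hU he hf hef) 1 (by omega)
    rcases Nat.lt_or_ge k r with hlt | hge
    · have h1 := ih (k + 2) (by omega)
      have h2 := ih (k + 1) (by omega)
      have h3 := ih k (by omega)
      have h4 := le_finrank_polarPower_sup hb he hf hef (k := k) (fun T hT hfin => by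
        obtain ⟨M, hMU, hM, hMr, -⟩ := hU.exists_lagrangian hb
        obtain ⟨x, hx, z, hz, hxz⟩ := PolarData.exists_hyperbolic (D := PolarData.ofAlt hb)
          (Y := T) hMU ((isTS_ofAlt hb).2 hM)
          (fun x hx h => hU.nondegenerate hb x (hMU hx) h) (by omega)
        exact ⟨x, ⟨hMU hx.1, hx.2⟩, z, hz, hxz⟩)
      rw [show k + 1 + 1 = k + 2 from rfl, mul_add, mul_one, chooseSubTwo_recurrence,
        choose_add_two]
      omega
    · obtain rfl : k = r := by omega
      refine le_trans (le_of_eq ?_) (Nat.le_add_left _ _)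
      exact Nat.choose_symm_of_eq_add (by omega)

/-- The dimension of the span of the Grassmann embedding of a symplectic form. -/
theorem finrank_polarPower_add [FiniteDimensional F V] (hb : b.IsAlt) {r : ℕ} {U : Submodule F V}
    (hU : IsHyperbolicSum b r U) {k : ℕ} (hk : k ≤ r + 1) :
    Module.finrank F ((PolarData.ofAlt hb).polarPower U k) + chooseSubTwo (2 * r) k
      = (2 * r).choose k := by
  have h1 := hU.le_finrank_polarPower_add hb k hk
  have h2 := hU.finrank_wedgeFixed_add_le hb k hk
  have h3 := Submodule.finrank_mono (polarPower_le_wedgeFixed hb U k)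
  omega

end IsHyperbolicSum

/-- Every subspace is the orthogonal sum of hyperbolic planes and of its radical. -/
theorem exists_isHyperbolicSum [FiniteDimensional F V] (hb : b.IsAlt) (W : Submodule F V) :
    ∃ (r : ℕ) (U S : Submodule F V), IsHyperbolicSum b r U ∧ W = U ⊔ S ∧
      ∀ s ∈ S, ∀ w ∈ W, b s w = 0 := by
  obtain ⟨m, hm⟩ : ∃ m, Module.finrank F W = m := ⟨_, rfl⟩
  induction m using Nat.strong_induction_on generalizing W with
  | _ m ih =>
    by_cases h0 : ∀ x ∈ W, ∀ y ∈ W, b x y = 0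
    · exact ⟨0, ⊥, W, .bot, (bot_sup_eq W).symm, h0⟩
    push Not at h0
    obtain ⟨e, he, f', hf', hef'⟩ := h0
    set f := (b e f')⁻¹ • f' with hf_def
    have hf : f ∈ W := Submodule.smul_mem _ _ hf'
    have hef : b e f = 1 := by rw [hf_def, map_smul, smul_eq_mul, inv_mul_cancel₀ hef']
    have hfe : b f e = -1 := by rw [← hb.neg_eq, hef]
    set W' := W ⊓ LinearMap.ker (b e) ⊓ LinearMap.ker (b f) with hW'
    have hlt : W' < W := by
      refine lt_of_le_of_ne (inf_le_left.trans inf_le_left) fun h => ?_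
      have : b e f = 0 := (h ▸ hf : f ∈ W').1.2
      rw [hef] at this
      exact one_ne_zero this
    have hWsup : W = W' ⊔ F ∙ e ⊔ F ∙ f := by
      refine le_antisymm (fun w hw => ?_) (sup_le (sup_le hlt.le
        ((Submodule.span_singleton_le_iff_mem _ _).2 he))
        ((Submodule.span_singleton_le_iff_mem _ _).2 hf))
      -- The bracket is the orthogonal projection of w along the plane ⟨e, f⟩.
      have e1 : w = (w + b f w • e - b e w • f) + -(b f w) • e + b e w • f := by module
      rw [e1]
      refine Submodule.add_mem_sup (Submodule.add_mem_sup ⟨⟨Submodule.sub_mem _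
        (Submodule.add_mem _ hw (Submodule.smul_mem _ _ he)) (Submodule.smul_mem _ _ hf), ?_⟩, ?_⟩
        (Submodule.smul_mem _ _ (Submodule.mem_span_singleton_self e)))
        (Submodule.smul_mem _ _ (Submodule.mem_span_singleton_self f))
      · simp [hb e, hef]
      · simp [hb f, hfe]
    obtain ⟨r, U, S, hU, hUS, hS⟩ := ih _ (hm ▸ Submodule.finrank_lt_finrank_of_lt hlt) W' rfl
    have hUW : U ≤ W' := hUS ▸ le_sup_left
    have hSW : S ≤ W' := hUS ▸ le_sup_right
    refine ⟨r + 1, U ⊔ F ∙ e ⊔ F ∙ f, S, .sup hU (fun u hu => (hUW hu).1.2)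
      (fun u hu => (hUW hu).2) hef, ?_, fun s hs w hw => ?_⟩
    · rw [hWsup, hUS]
      simp only [sup_assoc, sup_comm, sup_left_comm]
    · have hs' := hSW hs
      rw [hWsup] at hw
      exact apply_eq_zero_of_mem_sup_span (apply_eq_zero_of_mem_sup_span (hS s hs)
        (hb.isRefl _ _ hs'.1.2)) (hb.isRefl _ _ hs'.2) w hw

/-- The terms with second index 0 and 1 vanish; the rest is Vandermonde's identity in degree k - 2.
-/
theorem sum_antidiagonal_chooseSubTwo (s m k : ℕ) :
    ∑ x ∈ Finset.HasAntidiagonal.antidiagonal k, s.choose x.1 * chooseSubTwo m x.2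
      = chooseSubTwo (s + m) k := by
  rcases k with _ | _ | k
  · rfl
  · rfl
  · rw [Finset.Nat.antidiagonal_succ', Finset.sum_cons, Finset.sum_map,
      Finset.Nat.antidiagonal_succ', Finset.sum_cons, Finset.sum_map]
    simp [chooseSubTwo, Nat.add_choose_eq]

/-- The dimension of the span of the Grassmann embedding of an alternating form, for subspaces of
dimension at most the dimension of a totally isotropic subspace meeting the radical trivially. -/
theorem finrank_polarPower_ofAlt_add [FiniteDimensional F V] (hb : b.IsAlt) {W M : Submodule F V}
    (hMW : M ≤ W) (hM : ∀ x ∈ M, ∀ y ∈ M, b x y = 0)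
    (hMn : ∀ x ∈ M, (∀ u ∈ W, b x u = 0) → x = 0) {k : ℕ} (hk : k ≤ Module.finrank F M) :
    Module.finrank F ((PolarData.ofAlt hb).polarPower W k)
      + chooseSubTwo (Module.finrank F W) k = (Module.finrank F W).choose k := by
  obtain ⟨r, U, S, hU, rfl, hS⟩ := exists_isHyperbolicSum hb W
  have hd : Disjoint U S := Submodule.disjoint_def.2 fun x hxU hxS =>
    hU.nondegenerate hb x hxU fun u hu => hS x hxS u (Submodule.mem_sup_left hu)
  have hSS : ∀ x ∈ S, ∀ y ∈ S, b x y = 0 := fun x hx y hy => hS x hx y (Submodule.mem_sup_right hy)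
  -- If dim M > r, a Lagrangian Y of U would be orthogonal to a non-orthogonal pair in U + S. But
  -- the vectors of U + S orthogonal to Y form part of Y + S, which is isotropic.
  have hMr : Module.finrank F M ≤ r := by
    by_contra hlt
    obtain ⟨Y, hYU, hY, hYr, hmax⟩ := hU.exists_lagrangian hb
    obtain ⟨x, hx, z, hz, hxz⟩ := PolarData.exists_hyperbolic (D := PolarData.ofAlt hb) (Y := Y)
      hMW ((isTS_ofAlt hb).2 hM) hMn (by omega)
    have key : ∀ v ∈ U ⊔ S, v ∈ (PolarData.ofAlt hb).perp Y → v ∈ Y ⊔ S := by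
      intro v hv hvY
      obtain ⟨u, hu, s, hs, rfl⟩ := Submodule.mem_sup.1 hv
      refine Submodule.add_mem_sup (hmax u hu fun y hy => ?_) hs
      have : b y (u + s) = 0 := hvY y hy
      rwa [map_add, hb.isRefl _ _ (hS s hs y (Submodule.mem_sup_left (hYU hy))), add_zero] at this
    have hYS := (isTS_ofAlt hb).1 (((isTS_ofAlt hb).2 hY).sup ((isTS_ofAlt hb).2 hSS)
      fun y hy s hs => hb.isRefl _ _ (hS s hs y (Submodule.mem_sup_left (hYU hy))))
    exact hxz (hYS x (key x (hMW hx.1) hx.2) z (key z hz.1 hz.2))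
  have hfin : Module.finrank F ↥(U ⊔ S) = Module.finrank F S + 2 * r := by
    have := Submodule.finrank_sup_add_finrank_inf_eq U S
    rw [hd.eq_bot, finrank_bot, hU.finrank_eq hb] at this
    omega
  rw [PolarData.finrank_polarPower_sup ((isTS_ofAlt hb).2 hSS)
    (fun s hs u hu => hS s hs u (Submodule.mem_sup_left hu)) hd, hfin,
    ← sum_antidiagonal_chooseSubTwo, Nat.add_choose_eq, ← Finset.sum_add_distrib]
  refine Finset.sum_congr rfl fun x hx => ?_
  rw [← mul_add, hU.finrank_polarPower_add hb]
  have := Finset.HasAntidiagonal.mem_antidiagonal.1 hx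
  omega

end Alternating

/-! ### Polar forms as polar data -/

/-- The trace w ↦ w + σ(w) is onto the fixed field. Were it zero, then 1 = -1 and σ(t) = -t = t for
all t; otherwise an element of nonzero trace is rescaled. This makes a vector singular by adding a
multiple of a singular vector not orthogonal to it. -/
theorem exists_add_map_eq {F : Type*} [Field F] {σ : F →+* F} (invol : ∀ a, σ (σ a) = a)
    (nontriv : σ ≠ RingHom.id F) {a : F} (ha : σ a = a) : ∃ w, a + (w + σ w) = 0 := by
  obtain ⟨t, ht⟩ : ∃ t, t + σ t ≠ 0 := by
    by_contra! h
    refine nontriv (RingHom.ext fun t => ?_)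
    have h1 : (1 : F) = -1 := by
      have := h 1
      rw [map_one] at this
      exact eq_neg_of_add_eq_zero_left this
    have h2 := eq_neg_of_add_eq_zero_right (h t)
    rw [h2, RingHom.id_apply, neg_eq_neg_one_mul, ← h1, one_mul]
  refine ⟨-(a * (t / (t + σ t))), ?_⟩
  have h1 : σ (t + σ t) = t + σ t := by rw [map_add, invol, add_comm]
  rw [map_neg, map_mul, map_div₀, ha, h1]
  field_simp
  ring

namespace PolarForm

variable {F V : Type*} [Field F] [AddCommGroup V] [Module F V]

/-- The sesquilinear form and the singular vectors of a polar form. -/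
noncomputable def toData : PolarForm F V → PolarData F V
  | hermitian σ invol nontriv h herm =>
    { σ := σ
      invol := invol
      h := h
      refl := fun x y hxy => herm.isRefl x y hxy
      sing := fun x => h x x = 0
      sing_zero := map_zero _
      sing_self := fun _ hx => hx
      sing_add := fun x y hx hy hxy => by
        rw [h.map_add, LinearMap.add_apply, map_add, map_add, hx, hy, hxy, herm.isRefl x y hxy]
        simp
      sing_smul := fun c x hx => by
        rw [map_smul, LinearMap.map_smulₛₗ, LinearMap.smul_apply, hx, smul_zero, smul_zero]
      exists_sing := fun x z hx hxz => by
        have hzx : h z x ≠ 0 := fun h0 => hxz (herm.isRefl _ _ h0)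
        obtain ⟨w, hw⟩ := exists_add_map_eq invol nontriv (herm.eq z z)
        refine ⟨w / h z x, ?_⟩
        have e1 : h x z = σ (h z x) := (herm.eq z x).symm
        have e2 : σ (h z x) ≠ 0 := e1 ▸ hxz
        rw [h.map_add, LinearMap.add_apply, map_add, map_add, h.map_smulₛₗ,
          LinearMap.smul_apply, LinearMap.smul_apply, map_smul, map_smul, hx, e1, smul_zero,
          smul_zero, add_zero, smul_eq_mul, smul_eq_mul, div_mul_cancel₀ _ hzx, map_div₀,
          div_mul_cancel₀ _ e2, add_assoc, hw] }
  | alternating _ alt => PolarData.ofAlt alt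
  | quadratic q =>
    { σ := RingHom.id F
      invol := fun _ => rfl
      h := q.polarBilin
      refl := fun x y hxy => by
        rw [QuadraticMap.polarBilin_apply_apply] at hxy ⊢
        rwa [QuadraticMap.polar_comm]
      sing := fun x => q x = 0
      sing_zero := map_zero q
      sing_self := fun x hx => by
        rw [QuadraticMap.polarBilin_apply_apply, QuadraticMap.polar_self, hx, smul_zero]
      sing_add := fun x y hx hy hxy => by
        rw [QuadraticMap.polarBilin_apply_apply] at hxy
        rw [QuadraticMap.map_add q, hx, hy, hxy, add_zero, add_zero]
      sing_smul := fun c x hx => by rw [QuadraticMap.map_smul q, hx, smul_zero]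
      exists_sing := fun x z hx hxz => by
        rw [QuadraticMap.polarBilin_apply_apply] at hxz
        refine ⟨-(q z / QuadraticMap.polar q x z), ?_⟩
        rw [QuadraticMap.map_add q, QuadraticMap.map_smul q, hx, QuadraticMap.polar_smul_right,
          QuadraticMap.polar_comm q z x, smul_eq_mul, smul_eq_mul, mul_zero, neg_mul,
          div_mul_cancel₀ _ hxz, add_zero, add_neg_cancel] }

theorem isTS_toData_iff (η : PolarForm F V) (T : Submodule F V) :
    η.toData.IsTS T ↔ η.IsTotallySingular T := by
  cases η with
  | hermitian σ invol nontriv h herm =>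
    exact ⟨fun H x hx => (H x hx).2, fun H x hx => ⟨H x hx x hx, H x hx⟩⟩
  | alternating f alt => exact isTS_ofAlt alt
  | quadratic q =>
    refine ⟨fun H x hx => (H x hx).1, fun H x hx => ⟨H x hx, fun y hy => ?_⟩⟩
    change q (x + y) - q x - q y = 0
    rw [H x hx, H y hy, H _ (Submodule.add_mem _ hx hy), sub_zero, sub_zero]

theorem mem_radical_iff (η : PolarForm F V) (x : V) :
    x ∈ η.radical ↔ η.toData.sing x ∧ ∀ y, η.toData.h x y = 0 := by
  cases η with
  | hermitian σ invol nontriv h herm =>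
    exact ⟨fun H => ⟨LinearMap.congr_fun (LinearMap.mem_ker.1 H) x,
      LinearMap.congr_fun (LinearMap.mem_ker.1 H)⟩,
      fun H => LinearMap.mem_ker.2 (LinearMap.ext H.2)⟩
  | alternating f alt =>
    exact ⟨fun H => ⟨trivial, LinearMap.congr_fun (LinearMap.mem_ker.1 H)⟩,
      fun H => LinearMap.mem_ker.2 (LinearMap.ext H.2)⟩
  | quadratic q =>
    exact ⟨fun H => ⟨H.1, LinearMap.congr_fun H.2⟩, fun H => ⟨H.1, LinearMap.ext H.2⟩⟩

theorem reduction_isTotallySingular_map_mkQ (η : PolarForm F V) (T : Submodule F V) :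
    η.reduction.IsTotallySingular (T.map η.radical.mkQ) ↔ η.IsTotallySingular T := by
  cases η with
  | hermitian σ invol nontriv h herm =>
    refine ⟨fun H x hx y hy => H _ ⟨x, hx, rfl⟩ _ ⟨y, hy, rfl⟩, ?_⟩
    rintro H _ ⟨x, hx, rfl⟩ _ ⟨y, hy, rfl⟩
    exact H x hx y hy
  | alternating f alt =>
    refine ⟨fun H x hx y hy => H _ ⟨x, hx, rfl⟩ _ ⟨y, hy, rfl⟩, ?_⟩
    rintro H _ ⟨x, hx, rfl⟩ _ ⟨y, hy, rfl⟩
    exact H x hx y hy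
  | quadratic q =>
    refine ⟨fun H x hx => H _ ⟨x, hx, rfl⟩, ?_⟩
    rintro H _ ⟨x, hx, rfl⟩
    exact H x hx

/-! ### Complements of the radical and the reduced Witt index -/

section Complement

variable {η : PolarForm F V} {W : Submodule F V}

theorem finrank_map_mkQ (hW : IsCompl W η.radical) {T : Submodule F V} (hT : T ≤ W) :
    Module.finrank F (T.map η.radical.mkQ) = Module.finrank F T :=
  finrank_map_of_disjoint_ker _ _ fun x hx h0 => Submodule.disjoint_def.1 hW.disjoint x (hT hx)
    ((Submodule.Quotient.mk_eq_zero _).1 h0)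

/-- Singularity of x is essential: for a quadratic form in characteristic 2 the bilinear form may
stay degenerate on W. -/
theorem eq_zero_of_perp_complement (hW : IsCompl W η.radical) {x : V} (hx : x ∈ W)
    (hs : η.toData.sing x) (h : ∀ u ∈ W, η.toData.h x u = 0) : x = 0 := by
  refine Submodule.disjoint_def.1 hW.disjoint x hx ((η.mem_radical_iff x).2 ⟨hs, fun y => ?_⟩)
  obtain ⟨w, hw, r, hr, rfl⟩ :=
    Submodule.mem_sup.1 (hW.sup_eq_top ▸ Submodule.mem_top : y ∈ W ⊔ η.radical)
  rw [map_add, h w hw, η.toData.refl _ _ (((η.mem_radical_iff r).1 hr).2 x), add_zero]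

variable [FiniteDimensional F V]

theorem wittIndex_spec (η : PolarForm F V) :
    (∃ T : Submodule F V, η.IsTotallySingular T ∧ Module.finrank F T = η.wittIndex) ∧
      ∀ T : Submodule F V, η.IsTotallySingular T → Module.finrank F T ≤ η.wittIndex := by
  have hbdd : BddAbove {m | ∃ T : Submodule F V, η.IsTotallySingular T ∧ Module.finrank F T = m} :=
    ⟨Module.finrank F V, by rintro _ ⟨T, _, rfl⟩; exact Submodule.finrank_le T⟩
  have hne : {m | ∃ T : Submodule F V, η.IsTotallySingular T ∧ Module.finrank F T = m}.Nonempty :=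
    ⟨_, ⊥, (η.isTS_toData_iff ⊥).1 PolarData.isTS_bot, rfl⟩
  exact ⟨Nat.sSup_mem hne hbdd,
    fun T hT => le_csSup hbdd ⟨T, hT, rfl⟩⟩

theorem finrank_le_reducedWittIndex (hW : IsCompl W η.radical) {T : Submodule F V} (hT : T ≤ W)
    (hs : η.toData.IsTS T) : Module.finrank F T ≤ η.reducedWittIndex := by
  rw [← finrank_map_mkQ hW hT]
  exact (wittIndex_spec η.reduction).2 _ ((η.reduction_isTotallySingular_map_mkQ T).2
    ((η.isTS_toData_iff T).1 hs))

theorem exists_isTS_finrank_eq (hW : IsCompl W η.radical) :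
    ∃ T ≤ W, η.toData.IsTS T ∧ Module.finrank F T = η.reducedWittIndex := by
  obtain ⟨T', hT', hn⟩ := (wittIndex_spec η.reduction).1
  set T := T'.comap η.radical.mkQ ⊓ W with hT
  have hmap : T.map η.radical.mkQ = T' := by
    refine le_antisymm ((Submodule.map_mono inf_le_left).trans (Submodule.map_comap_le _ _)) ?_
    intro y hy
    obtain ⟨x, rfl⟩ := Submodule.mkQ_surjective _ y
    obtain ⟨w, hw, r, hr, rfl⟩ :=
      Submodule.mem_sup.1 (hW.sup_eq_top ▸ Submodule.mem_top : x ∈ W ⊔ η.radical)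
    have hr0 : η.radical.mkQ r = 0 := (Submodule.Quotient.mk_eq_zero _).2 hr
    rw [map_add, hr0, add_zero] at hy ⊢
    exact ⟨w, ⟨hy, hw⟩, rfl⟩
  refine ⟨T, inf_le_right, (η.isTS_toData_iff T).2 ?_, ?_⟩
  · rw [← reduction_isTotallySingular_map_mkQ, hmap]
    exact hT'
  · rw [← finrank_map_mkQ hW inf_le_right, hmap]
    exact hn

theorem finrank_polarPower_top (hW : IsCompl W η.radical) (k : ℕ) :
    Module.finrank F (η.toData.polarPower ⊤ k)
      = ∑ x ∈ Finset.HasAntidiagonal.antidiagonal k,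
          η.defect.choose x.1 * Module.finrank F (η.toData.polarPower W x.2) := by
  rw [← hW.sup_eq_top]
  exact PolarData.finrank_polarPower_sup
    (fun x hx => ⟨((η.mem_radical_iff x).1 hx).1, fun y _ => ((η.mem_radical_iff x).1 hx).2 y⟩)
    (fun s hs u _ => ((η.mem_radical_iff s).1 hs).2 u) hW.disjoint k

theorem polarPower_complement_eq_bot (hW : IsCompl W η.radical) {k : ℕ}
    (hk : η.reducedWittIndex < k) : η.toData.polarPower W k = ⊥ := by
  refine le_bot_iff.1 (PolarData.polarPower_le fun T hT hs => le_bot_iff.2 ?_)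
  rw [← Submodule.finrank_eq_zero (R := F), finrank_wedgePower]
  exact Nat.choose_eq_zero_of_lt ((finrank_le_reducedWittIndex hW hT hs).trans_lt hk)

theorem finrank_polarPower_complement (hW : IsCompl W η.radical)
    (hη : η.IsHermitian ∨ (η.IsQuadratic ∧ ringChar F ≠ 2)) {k : ℕ} (hk : k ≤ η.reducedWittIndex) :
    Module.finrank F (η.toData.polarPower W k) = (Module.finrank F W).choose k := by
  obtain ⟨M, hMW, hM, hMn⟩ := exists_isTS_finrank_eq hW
  rw [PolarData.polarPower_eq_wedgePower ?_ hMW hM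
    (fun x hx => eq_zero_of_perp_complement hW (hMW hx) (hM x hx).1) (hk.trans hMn.ge),
    finrank_wedgePower]
  clear hk hM hMn hW
  cases η with
  | hermitian σ invol nontriv h herm =>
    left
    by_contra! hσ
    exact nontriv (RingHom.ext hσ)
  | alternating f alt => rcases hη with h | h; exacts [h.elim, h.1.elim]
  | quadratic q =>
    rcases hη with h | h
    · exact h.elim
    · exact Or.inr ⟨Ring.two_ne_zero h.2, fun x y => QuadraticMap.polar_comm q x y⟩

theorem finrank_polarPower_complement_add (hW : IsCompl W η.radical)
    (hη : η.IsAlternating ∨ (η.IsQuadratic ∧ ringChar F = 2)) {k : ℕ}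
    (hk : k ≤ η.reducedWittIndex) :
    Module.finrank F (η.toData.polarPower W k) + chooseSubTwo (Module.finrank F W) k
      = (Module.finrank F W).choose k := by
  obtain ⟨M, hMW, hM, hMn⟩ := exists_isTS_finrank_eq hW
  have hM0 : ∀ x ∈ M, (∀ u ∈ W, η.toData.h x u = 0) → x = 0 :=
    fun x hx => eq_zero_of_perp_complement hW (hMW hx) (hM x hx).1
  have hkM := hk.trans hMn.ge
  clear hk hMn hW
  cases η with
  | hermitian σ invol nontriv h herm => rcases hη with h | h; exacts [h.elim, h.1.elim]
  | alternating f alt => exact finrank_polarPower_ofAlt_add alt hMW ((isTS_ofAlt alt).1 hM) hM0 hkM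
  | quadratic q =>
    rcases hη with h | h
    · exact h.elim
    have h2 : (2 : F) = 0 := by
      have := ringChar.Nat.cast_ringChar (R := F)
      rw [h.2] at this
      exact_mod_cast this
    have alt : (q.polarBilin : LinearMap.BilinForm F V).IsAlt := fun x => by
      rw [QuadraticMap.polarBilin_apply_apply, QuadraticMap.polar_self, two_nsmul, ← two_mul, h2,
        zero_mul]
    rw [← finrank_polarPower_ofAlt_add alt hMW (fun x hx y hy => (hM x hx).2 y hy) hM0 hkM]
    -- Isotropic subspaces of the polar form need not be singular for q, but up to the Witt index
    -- they add nothing to the span.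
    suffices H : (quadratic q).toData.polarPower W k = (PolarData.ofAlt alt).polarPower W k by
      rw [H]
    refine le_antisymm (PolarData.polarPower_le fun T hT hs => ?_)
      (PolarData.polarPower_le fun T hT hs => ?_)
    · exact PolarData.wedgePower_le_polarPower hT ((isTS_ofAlt alt).2 fun x hx => (hs x hx).2) k
    · exact PolarData.wedgePower_le_polarPower_of_isotropic hMW hM hM0 hkM hT
        ((isTS_ofAlt alt).1 hs)

end Complement

/-! ### The span of the Grassmann embedding as a polar power -/

section Embedding

theorem ιMulti_mem_wedgePower {T : Submodule F V} {k : ℕ} {v : Fin k → V} (hv : ∀ i, v i ∈ T) :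
    ExteriorAlgebra.ιMulti F k v ∈ wedgePower T k := by
  induction k with
  | zero =>
    rw [wedgePower_zero, ExteriorAlgebra.ιMulti_zero_apply]
    exact Submodule.one_le.1 le_rfl
  | succ k ih =>
    rw [ExteriorAlgebra.ιMulti_succ_apply]
    exact ι_mul_mem_wedgePower (hv 0) (ih fun i => hv i.succ)

variable [FiniteDimensional F V]

theorem wedgePower_eq_span_ιMulti {T : Submodule F V} {k : ℕ} (hT : Module.finrank F T = k) :
    wedgePower T k = F ∙ ExteriorAlgebra.ιMulti F k
      fun i => (Module.finBasisOfFinrankEq F T hT i : V) := by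
  set v : Fin k → V := fun i => (Module.finBasisOfFinrankEq F T hT i : V) with hv
  have hne : ExteriorAlgebra.ιMulti F k v ≠ 0 := fun h => by
    have hli : LinearIndependent F v :=
      (Module.finBasisOfFinrankEq F T hT).linearIndependent.map' T.subtype T.ker_subtype
    exact wedge_ne_zero hli (Subtype.ext h)
  refine (Submodule.eq_of_le_of_finrank_eq ((Submodule.span_singleton_le_iff_mem _ _).2
    (ιMulti_mem_wedgePower fun i => Subtype.prop _)) ?_).symm
  rw [finrank_span_singleton hne, finrank_wedgePower, hT, Nat.choose_self]

/-- The polar power ranges over singular subspaces of all dimensions, but larger ones reduce to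
dimension at most k, smaller ones contribute zero, and those of dimension k contribute the lines of
the embedding. -/
theorem map_submodule_grassmannSpan (η : PolarForm F V) (k : ℕ) :
    (Projectivization.Subspace.submodule (η.grassmannSpan k)).map (⋀[F]^k V).subtype
      = η.toData.polarPower ⊤ k := by
  refine le_antisymm ?_ (PolarData.polarPower_le fun T _ hT => ?_)
  · rw [Submodule.map_le_iff_le_comap]
    set P := (η.toData.polarPower ⊤ k).comap (⋀[F]^k V).subtype with hP
    have : η.grassmannSpan k ≤ P.projectivization := by
      refine Projectivization.Subspace.span_le_subspace_iff.2 ?_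
      rintro _ ⟨X, rfl⟩
      refine (Submodule.mk_mem_projectivization_iff P _).2 ?_
      exact PolarData.wedgePower_le_polarPower le_top ((η.isTS_toData_iff _).2 X.2) k
        (ιMulti_mem_wedgePower fun i => Subtype.prop _)
    have h2 := Projectivization.Subspace.submodule.monotone this
    rwa [Submodule.projectivization, OrderIso.apply_symm_apply] at h2
  · refine wedgePower_le_of_finrank_le fun T' hT' hfin => ?_
    rcases Nat.lt_or_eq_of_le hfin with hlt | heq
    · have : wedgePower T' k = ⊥ := by
        rw [← Submodule.finrank_eq_zero (R := F), finrank_wedgePower, Nat.choose_eq_zero_of_lt hlt]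
      rw [this]
      exact bot_le
    · rw [wedgePower_eq_span_ιMulti heq, Submodule.span_singleton_le_iff_mem]
      refine ⟨exteriorPower.ιMulti F k fun i => (Module.finBasisOfFinrankEq F T' heq i : V), ?_,
        rfl⟩
      refine (Projectivization.Subspace.mem_submodule_iff _ (wedge_ne_zero
        ((Module.finBasisOfFinrankEq F T' heq).linearIndependent.map'
          T'.subtype T'.ker_subtype))).2 ?_
      exact Projectivization.Subspace.subset_span _
        ⟨⟨⟨T', heq⟩, (η.isTS_toData_iff T').1 (hT.mono hT')⟩, rfl⟩

theorem embeddingDim_eq (η : PolarForm F V) (k : ℕ) :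
    η.embeddingDim k = Module.finrank F (η.toData.polarPower ⊤ k) := by
  rw [← map_submodule_grassmannSpan, Submodule.finrank_map_subtype_eq]
  rfl

end Embedding

end PolarForm

/-! ### The final count -/

/-- The second index k - i exceeds n exactly when i ≤ k - n - 1; those are the terms that D loses
from the full convolution with G. -/
theorem sum_antidiagonal_truncated {d k n : ℕ} (hnk : n < k) (D : ℕ → ℕ) (G : ℕ → ℤ)
    (hG : ∀ j ≤ n, (D j : ℤ) = G j) (hD : ∀ j, n < j → D j = 0) :
    ((∑ x ∈ Finset.HasAntidiagonal.antidiagonal k, d.choose x.1 * D x.2 : ℕ) : ℤ)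
      = ∑ x ∈ Finset.HasAntidiagonal.antidiagonal k, (d.choose x.1 : ℤ) * G x.2
        - ∑ i ∈ Finset.Icc 0 (k - n - 1), (d.choose i : ℤ) * G (k - i) := by
  rw [eq_sub_iff_add_eq', ← eq_sub_iff_add_eq]
  push_cast
  rw [← Finset.sum_sub_distrib,
    Finset.Nat.sum_antidiagonal_eq_sum_range_succ_mk]
  have hsub : Finset.Icc 0 (k - n - 1) ⊆ Finset.range (k + 1) := fun i hi => by
    rw [Finset.mem_Icc] at hi
    rw [Finset.mem_range]
    omega
  rw [← Finset.sum_subset hsub]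
  · refine Finset.sum_congr rfl fun i hi => ?_
    rw [Finset.mem_Icc] at hi
    rw [hD (k - i) (by omega)]
    simp
  · intro i hi hi'
    rw [Finset.mem_range] at hi
    rw [Finset.mem_Icc] at hi'
    rw [hG (k - i) (by omega), sub_self]

theorem corollary1 {F V : Type*} [Field F] [AddCommGroup V] [Module F V] [FiniteDimensional F V]
    (N n d k : ℕ) (η : PolarForm F V) (hN : Module.finrank F V = N)
    (hn : η.reducedWittIndex = n) (hn1 : 1 < n) (hd : η.defect = d)
    (hnk : n < k) (hkd : k ≤ n + d) :
    ((η.IsHermitian ∨ (η.IsQuadratic ∧ ringChar F ≠ 2)) →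
      (η.embeddingDim k : ℤ) = (N.choose k : ℤ)
        - ∑ i ∈ Finset.Icc 0 (k - n - 1), ((N - d).choose (k - i) : ℤ) * (d.choose i : ℤ)) ∧
    ((η.IsAlternating ∨ (η.IsQuadratic ∧ ringChar F = 2)) →
      (η.embeddingDim k : ℤ) = (N.choose k : ℤ) - (N.choose (k - 2) : ℤ)
        - ∑ i ∈ Finset.Icc 0 (k - n - 1), ((N - d).choose (k - i) : ℤ) * (d.choose i : ℤ)
        + ∑ i ∈ Finset.Icc 0 (k - n - 1), ((N - d).choose (k - i - 2) : ℤ) * (d.choose i : ℤ)) ∧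
    η.grassmannSpan k < ⊤ := by
  obtain ⟨W, hW'⟩ := Submodule.exists_isCompl η.radical
  have hW := hW'.symm
  obtain ⟨m, hm⟩ : ∃ m, Module.finrank F W = m := ⟨_, rfl⟩
  have hNdm : N = d + m := by
    rw [← hN, ← hd, ← hm, add_comm, PolarForm.defect, Submodule.finrank_add_eq_of_isCompl hW]
  have hNd : N - d = m := by omega
  have hdim := η.embeddingDim_eq k
  rw [PolarForm.finrank_polarPower_top hW, hd] at hdim
  have hbig : ∀ j, n < j → Module.finrank F (η.toData.polarPower W j) = 0 := fun j hj => by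
    rw [PolarForm.polarPower_complement_eq_bot hW (hn ▸ hj), finrank_bot]
  rw [hNd]
  refine ⟨fun hη => ?_, fun hη => ?_, ?_⟩
  · rw [hdim, sum_antidiagonal_truncated hnk _ (fun j => (m.choose j : ℤ)) (fun j hj => by
      rw [PolarForm.finrank_polarPower_complement hW hη (hn ▸ hj), hm]) hbig, hNdm,
      Nat.add_choose_eq]
    push_cast
    congr 1
    exact Finset.sum_congr rfl fun i _ => mul_comm _ _
  · rw [hdim, sum_antidiagonal_truncated hnk _
      (fun j => (m.choose j : ℤ) - (chooseSubTwo m j : ℤ)) (fun j hj => by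
      rw [← hm, ← PolarForm.finrank_polarPower_complement_add hW hη (hn ▸ hj)]
      push_cast
      ring) hbig, hNdm]
    -- Truncated subtraction is harmless in the result, since every k - i occurring there exceeds n
    -- > 1.
    have h2 : ∀ l j, 2 ≤ j → chooseSubTwo l j = l.choose (j - 2) := by
      intro l j hj
      obtain ⟨j, rfl⟩ := Nat.exists_eq_add_of_le' hj
      rfl
    rw [← h2 _ k (by omega), ← sum_antidiagonal_chooseSubTwo, Nat.add_choose_eq]
    push_cast
    simp only [mul_sub, Finset.sum_sub_distrib]
    have e1 : ∑ i ∈ Finset.Icc 0 (k - n - 1), (d.choose i : ℤ) * (m.choose (k - i) : ℤ)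
        = ∑ i ∈ Finset.Icc 0 (k - n - 1), (m.choose (k - i) : ℤ) * (d.choose i : ℤ) :=
      Finset.sum_congr rfl fun i _ => mul_comm _ _
    have e2 : ∑ i ∈ Finset.Icc 0 (k - n - 1), (d.choose i : ℤ) * (chooseSubTwo m (k - i) : ℤ)
        = ∑ i ∈ Finset.Icc 0 (k - n - 1), (m.choose (k - i - 2) : ℤ) * (d.choose i : ℤ) := by
      refine Finset.sum_congr rfl fun i hi => ?_
      rw [Finset.mem_Icc] at hi
      rw [h2 _ _ (by omega), mul_comm]
    rw [e1, e2]
    ring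
  · rw [lt_top_iff_ne_top]
    intro htop
    have hfull : η.embeddingDim k = N.choose k := by
      rw [PolarForm.embeddingDim, htop, map_top, finrank_top, exteriorPower.finrank_eq, hN]
    -- If m ≤ n, then W itself is totally singular, hence zero, against n > 1.
    have hmn : n + 1 ≤ m := by
      obtain ⟨M, hMW, hM, hMn⟩ := PolarForm.exists_isTS_finrank_eq hW
      by_contra hlt
      have hMW' : M = W := Submodule.eq_of_le_of_finrank_le hMW (by omega)
      have hM0 : M = ⊥ := (Submodule.eq_bot_iff _).2 fun x hx =>
        PolarForm.eq_zero_of_perp_complement hW (hMW hx) (hM x hx).1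
          fun u hu => (hM x hx).2 u (hMW' ▸ hu)
      rw [hM0, finrank_bot] at hMn
      omega
    have hlt : ∑ x ∈ Finset.HasAntidiagonal.antidiagonal k,
        d.choose x.1 * Module.finrank F (η.toData.polarPower W x.2)
        < ∑ x ∈ Finset.HasAntidiagonal.antidiagonal k, d.choose x.1 * m.choose x.2 := by
      -- Degree n + 1 is the first in which the W-part vanishes; C(d, k-n-1) is positive because k ≤
      -- n + d.
      refine Finset.sum_lt_sum (fun x _ => Nat.mul_le_mul_left _ ?_) ⟨(k - n - 1, n + 1), ?_, ?_⟩
      · rw [← hm, ← finrank_wedgePower]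
        exact Submodule.finrank_mono (PolarData.polarPower_le_wedgePower W _)
      · rw [Finset.HasAntidiagonal.mem_antidiagonal]
        omega
      · rw [hbig _ (Nat.lt_succ_self n), mul_zero]
        exact Nat.mul_pos (Nat.choose_pos (by omega)) (Nat.choose_pos hmn)
    rw [← Nat.add_choose_eq, ← hNdm, ← hdim, hfull] at hlt
    exact lt_irrefl _ hlt
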